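/- Let $\Bbbk$ be a commutative ring. A differential graded quiver $\mathcal Q$ is a (small) set $\mathrm{Ob}\,\mathcal Q$ together with a complex of $\Bbbk$-modules $\mathcal Q(X,Y)$ (differential of degree $+1$) for each pair of objects; a morphism is a map of objects together with chain maps $\mathcal Q(X,Y)\to\mathcal A(Xf,Yf)$. These form a category $A_1$. Operators are written on the right, with the Koszul rule $(x\otimes y)(f\otimes g)=(-1)^{|y||f|}xf\otimes yg$; $(sM)^d=M[1]^d=M^{d+1}$, $s^k:M\to M[k]$ is the identity on elements, and $(M\otimes N)[k]=M\otimes (N[k])$ with $s^k=1\otimes s^k$. An $A_\infty$-category $\mathcal A$ is a graded quiver with $\Bbbk$-linear maps $b_n:s\mathcal A(X_0,X_1)\otimes\dots\otimes s\mathcal A(X_{n-1},X_n)\to s\mathcal A(X_0,X_n)$, $n\ge1$, of degree $1$ such that $\sum_{r+n+t=m}(1^{\otimes r}\otimes b_n\otimes1^{\otimes t})b_{r+1+t}=0$ for all $m\ge1$. A strict $A_\infty$-functor $f:\mathcal A\to\mathcal B$ (one whose components $f_n$, $n>1$, vanish) is a map of objects together with degree $0$ maps $f_1:s\mathcal A(X,Y)\to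 s\mathcal B(Xf,Yf)$ such that $f_1^{\otimes n}b_n=b_nf_1$ for all $n\ge1$. $A_\infty$-categories and strict $A_\infty$-functors form a category $\mathrm{strict}A_\infty$, and $\mathcal U:\mathrm{strict}A_\infty\to A_1$, $\mathcal A\mapsto(\mathcal A,m_1)$, $m_1=s\,b_1s^{-1}$, is the forgetful functor. For a differential graded quiver $\mathcal Q$ let $\mathcal F\mathcal Q$ be the following graded quiver with operations: $\mathrm{Ob}\,\mathcal F\mathcal Q=\mathrm{Ob}\,\mathcal Q$, $$s\mathcal F\mathcal Q(X,Y)=\bigoplus_{n\ge1}\bigoplus_{t}s\mathcal F_t\mathcal Q(X,Y),\qquad s\mathcal F_t\mathcal Q(X,Y)=\bigoplus_{X=X_0,X_1,\dots,X_n=Y}s\mathcal Q(X_0,X_1)\otimes\dots\otimes s\mathcal Q(X_{n-1},X_n)[-|t|],$$ where $t$ runs over (isomorphism classes of) plane rooted trees with $n$ input vertices all of whose internal vertices have at least two incoming edges, and $|t|$ is the number of internal vertices of $t$. For $k>1$, $b_k$ is the sum of the maps $$s^{|t_1|}\otimes\dots\otimes s^{|t_{k-1}|}\otimes s^{|t_k|-|t|}:s\mathcal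 F_{t_1}\mathcal Q(Y_0,Y_1)\otimes\dots\otimes s\mathcal F_{t_k}\mathcal Q(Y_{k-1},Y_k)\to s\mathcal F_t\mathcal Q(Y_0,Y_k),$$ where $t$ is obtained by grafting $t_1,\dots,t_k$ (in this order) onto a new lowest internal vertex. On $s\mathcal F_t\mathcal Q$, $b_1$ is the sum of the differential $d$ of the shifted tensor product (which is $(-1)^{|t|}\sum_i1^{\otimes i-1}\otimes d_{s\mathcal Q}\otimes1^{\otimes n-i}$ on elements, where $d_{s\mathcal Q}=s^{-1}d_{\mathcal Q}s$) and of the maps $(-1)^{1+h}(1^{\otimes n-1}\otimes s^{-1}):s\mathcal F_t\mathcal Q\to s\mathcal F_{t'}\mathcal Q$ over all trees $t'$ of the above kind with a distinguished internal edge $e$ whose contraction gives $t$; here $h$ is the position (counted from $1$) of the upper vertex of $e$ in the linear order of the internal vertices of $t'$ in which each vertex precedes those above it and, of two incomparable vertices, the left one comes first. Then every $\mathcal F\mathcal Q$ is an $A_\infty$-category, and there is a functor $\mathcal F:A_1\to\mathrm{strict}A_\infty$ which is $\mathcal Q\mapsto\mathcal F\mathcal Q$ on objects and is left adjoint to $\mathcal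 U$. The unit of the adjunction can be chosen to be the inclusion $\mathcal Q\to(\mathcal F\mathcal Q,m_1)$ of the summand of the tree without internal vertices, so that the adjunction bijection $\mathrm{strict}A_\infty(\mathcal F\mathcal Q,\mathcal A)\to A_1(\mathcal Q,\mathcal U\mathcal A)$ is restriction to $\mathcal Q$. -/

import Mathlib

open CategoryTheory
open scoped DirectSum TensorProduct

universe u

noncomputable section

namespace AInf

/-! ### Differential graded quivers -/

/-- A differential graded `k`-quiver: a small set of objects and a complex of `k`-modules
(differential of degree `+1`) for each pair of objects. -/
structure DGQuiver (k : Type u) [CommRing k] where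
  Obj : Type u
  Hom : Obj → Obj → CochainComplex (ModuleCat.{u} k) ℤ

/-- A morphism of differential graded quivers: a map on objects and chain maps on morphisms. -/
structure DGQuiver.Morphism {k : Type u} [CommRing k] (Q R : DGQuiver k) where
  obj : Q.Obj → R.Obj
  map : ∀ X Y : Q.Obj, Q.Hom X Y ⟶ R.Hom (obj X) (obj Y)

/-- The category of differential graded quivers. -/
instance DGQuiver.category (k : Type u) [CommRing k] : Category (DGQuiver k) where
  Hom Q R := DGQuiver.Morphism Q R
  id Q := ⟨fun X => X, fun X Y => 𝟙 (Q.Hom X Y)⟩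
  comp f g := ⟨fun X => g.obj (f.obj X), fun X Y => f.map X Y ≫ g.map (f.obj X) (f.obj Y)⟩
  id_comp f := by simp
  comp_id f := by simp
  assoc f g h := by simp

/-! ### Graded quivers and tensor products along paths

A graded `k`-module is a family of `k`-modules indexed by `ℤ`. The shift `sA` of a graded quiver
`A` is not given a name: an element of `A(X, Y)` of degree `p` is the same as an element of
`sA(X, Y)` of degree `p - 1`. -/

/-- A graded `k`-quiver. -/
structure GradedQuiver (k : Type u) [CommRing k] where
  Obj : Type u
  Hom : Obj → Obj → ℤ → ModuleCat.{u} k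

/-- The graded quiver underlying a differential graded quiver. -/
abbrev DGQuiver.toGraded {k : Type u} [CommRing k] (Q : DGQuiver k) : GradedQuiver k where
  Obj := Q.Obj
  Hom X Y p := (Q.Hom X Y).X p

/-- `DegPath O X Y`: a sequence `X = X₀, X₁, …, Xₙ = Y` of elements of `O`, with `n ≥ 1`, together
with integers `p₁, …, pₙ`. It indexes the summand `A(X₀, X₁)^{p₁} ⊗ ⋯ ⊗ A(Xₙ₋₁, Xₙ)^{pₙ}`
of `TⁿA(X, Y)`. -/
inductive DegPath (O : Type u) : O → O → Type u
  | single {X Y : O} (p : ℤ) : DegPath O X Y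
  | cons {X Z Y : O} (p : ℤ) (w : DegPath O Z Y) : DegPath O X Y

namespace DegPath

variable {O : Type u}

/-- The number `n` of steps. -/
def length : {X Y : O} → DegPath O X Y → ℕ
  | _, _, single _ => 1
  | _, _, cons _ w => w.length + 1

/-- The degree `∑ (pᵢ - 1)` of the corresponding summand of `TⁿsA`. -/
def sdeg : {X Y : O} → DegPath O X Y → ℤ
  | _, _, single p => p - 1
  | _, _, cons p w => (p - 1) + w.sdeg

/-- Concatenation. -/
def append : {X Z Y : O} → DegPath O X Z → DegPath O Z Y → DegPath O X Y
  | _, _, _, single p, w' => cons p w'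
  | _, _, _, cons p w, w' => cons p (w.append w')

end DegPath

namespace GradedQuiver

variable {k : Type u} [CommRing k] (A : GradedQuiver k)

/-- `A(X₀, X₁)^{p₁} ⊗ ⋯ ⊗ A(Xₙ₋₁, Xₙ)^{pₙ}`. -/
def tensor : {X Y : A.Obj} → DegPath A.Obj X Y → ModuleCat.{u} k
  | X, Y, .single p => A.Hom X Y p
  | X, _, @DegPath.cons _ _ Z _ p w => ModuleCat.of k (A.Hom X Z p ⊗[k] tensor w)

/-- A non-empty sequence of composable homogeneous elements `x₁, …, xₙ` of `A`,
`xᵢ ∈ A(Xᵢ₋₁, Xᵢ)^{pᵢ}`. -/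
inductive Word : A.Obj → A.Obj → Type u
  | single {X Y : A.Obj} {p : ℤ} (x : A.Hom X Y p) : Word X Y
  | cons {X Z Y : A.Obj} {p : ℤ} (x : A.Hom X Z p) (w : Word Z Y) : Word X Y

variable {A}

/-- The objects and degrees of a word. -/
def Word.shape : {X Y : A.Obj} → A.Word X Y → DegPath A.Obj X Y
  | _, _, @Word.single _ _ _ _ _ p _ => .single p
  | _, _, @Word.cons _ _ _ _ _ _ p _ w => .cons p w.shape

/-- The total degree of a word, its letters being regarded as elements of `sA`. -/
def Word.sdeg {X Y : A.Obj} (w : A.Word X Y) : ℤ := w.shape.sdeg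

/-- The element `x₁ ⊗ ⋯ ⊗ xₙ`. -/
def Word.tprod : {X Y : A.Obj} → (w : A.Word X Y) → A.tensor w.shape
  | _, _, .single x => x
  | _, _, .cons x w => x ⊗ₜ[k] w.tprod

/-- The sum of `G v z` over all ways to cut a word into two non-empty words, `w = v z`. -/
def Word.splitSum {N : Type u} [AddCommGroup N] : {X Y : A.Obj} →
    (∀ Z : A.Obj, A.Word X Z → A.Word Z Y → N) → A.Word X Y → N
  | _, _, _, .single _ => 0
  | _, _, G, @Word.cons _ _ _ _ Z _ _ x w =>
      G Z (.single x) w + Word.splitSum (fun Z' v z => G Z' (.cons x v) z) w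

/-- The image of a word under a map of graded quivers. -/
def Word.map {B : GradedQuiver k} (f : A.Obj → B.Obj)
    (f₁ : ∀ (X Y : A.Obj) (p : ℤ), A.Hom X Y p →ₗ[k] B.Hom (f X) (f Y) p) :
    {X Y : A.Obj} → A.Word X Y → B.Word (f X) (f Y)
  | X, Y, .single x => .single (f₁ X Y _ x)
  | X, _, @Word.cons _ _ _ _ Z _ _ x w => .cons (f₁ X Z _ x) (w.map f f₁)

theorem Word.sdeg_map {B : GradedQuiver k} (f : A.Obj → B.Obj)
    (f₁ : ∀ (X Y : A.Obj) (p : ℤ), A.Hom X Y p →ₗ[k] B.Hom (f X) (f Y) p)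
    {X Y : A.Obj} (w : A.Word X Y) : (w.map f f₁).sdeg = w.sdeg := by
  induction w with
  | single x => rfl
  | cons x w ih =>
    simp only [Word.sdeg, Word.map, Word.shape, DegPath.sdeg] at ih ⊢
    rw [ih]

end GradedQuiver

/-! ### A∞-categories -/

/-- A graded quiver `A` with `k`-linear maps
`bₙ : sA(X₀, X₁) ⊗ ⋯ ⊗ sA(Xₙ₋₁, Xₙ) → sA(X₀, Xₙ)`, `n ≥ 1`, of degree `1`. They are given on the
summands `A(X₀, X₁)^{p₁} ⊗ ⋯ ⊗ A(Xₙ₋₁, Xₙ)^{pₙ}`, with values in `A(X₀, Xₙ)^q`, where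
`∑ (pᵢ - 1) + 1 = q - 1`. -/
structure AInfData (k : Type u) [CommRing k] extends GradedQuiver k where
  b : ∀ {X Y : Obj} (w : DegPath Obj X Y) (q : ℤ), w.sdeg + 1 = q - 1 →
    (toGradedQuiver.tensor w →ₗ[k] Hom X Y q)

namespace AInfData

variable {k : Type u} [CommRing k] (A : AInfData k)

/-- `(x₁ ⊗ ⋯ ⊗ xₙ) bₙ`, as an element of `A(X, Y)^q`. -/
def bWord {X Y : A.Obj} (w : A.Word X Y) (q : ℤ) (h : w.sdeg + 1 = q - 1) : A.Hom X Y q :=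
  A.b w.shape q h w.tprod

/-- `(x₁ ⊗ ⋯ ⊗ xₙ) bₙ`, its degree being computed from the word. -/
def bVal {X Y : A.Obj} (w : A.Word X Y) : A.Hom X Y (w.sdeg + 2) :=
  A.bWord w (w.sdeg + 2) (by ring)

/-- The sum of `F ((x₁ ⊗ ⋯ ⊗ xₘ)(bₙ ⊗ 1^{⊗ t}))` over all `n + t = m`, `n ≥ 1`. Operators act on
the right, so that moving `bₙ` (of degree `1`) past the last `t` letters produces the sign `(-1)`
to the power of their total degree in `sA`. -/
def headSum {N : Type u} [AddCommGroup N] {X Y : A.Obj} (F : A.Word X Y → N)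
    (w : A.Word X Y) : N :=
  F (.single (A.bVal w)) +
    w.splitSum (fun _ v z => z.sdeg.negOnePow • F (.cons (A.bVal v) z))

/-- The sum of `F ((x₁ ⊗ ⋯ ⊗ xₘ)(1^{⊗ r} ⊗ bₙ ⊗ 1^{⊗ t}))` over all `r + n + t = m`, `n ≥ 1`. -/
def bSum {N : Type u} [AddCommGroup N] : {X Y : A.Obj} → (A.Word X Y → N) → A.Word X Y → N
  | _, _, F, .single x => A.headSum F (.single x)
  | _, _, F, .cons x w => A.headSum F (.cons x w) + bSum (fun w' => F (.cons x w')) w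

/-- The equations `∑_{r + n + t = m} (1^{⊗ r} ⊗ bₙ ⊗ 1^{⊗ t}) b_{r + 1 + t} = 0` for all `m ≥ 1`,
evaluated on all `x₁ ⊗ ⋯ ⊗ xₘ` with homogeneous `xᵢ`. All summands lie in one and the same
graded component of `A(X, Y)`; they are added up in the direct sum of the components. -/
def IsAInf : Prop :=
  ∀ (X Y : A.Obj) (w : A.Word X Y),
    A.bSum (fun w' => (DirectSum.of (fun q => A.Hom X Y q) (w'.sdeg + 2) (A.bVal w') :
      ⨁ q, A.Hom X Y q)) w = 0

end AInfData

/-- An A∞-category over `k`. -/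
structure AInfCategory (k : Type u) [CommRing k] extends AInfData k where
  isAInf : toAInfData.IsAInf

/-- A strict A∞-functor `f : A → B`: an A∞-functor whose components `fₙ`, `n > 1`, vanish.
It consists of a map on objects and `k`-linear maps `f₁ : sA(X, Y) → sB(Xf, Yf)` of degree `0`,
such that `f₁^{⊗ n} bₙ = bₙ f₁` for all `n ≥ 1`. -/
@[ext]
structure StrictFunctor {k : Type u} [CommRing k] (A B : AInfCategory k) where
  obj : A.Obj → B.Obj
  map : ∀ (X Y : A.Obj) (p : ℤ), A.Hom X Y p →ₗ[k] B.Hom (obj X) (obj Y) p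
  comm : ∀ (X Y : A.Obj) (w : A.Word X Y) (q : ℤ) (h : w.sdeg + 1 = q - 1),
    B.bWord (w.map obj map) q (by rw [GradedQuiver.Word.sdeg_map, h]) =
      map X Y q (A.bWord w q h)

theorem GradedQuiver.Word.map_id {k : Type u} [CommRing k] {A : GradedQuiver k} {X Y : A.Obj}
    (w : A.Word X Y) : w.map (B := A) (fun X => X) (fun _ _ _ => LinearMap.id) = w := by
  induction w with
  | single x => rfl
  | cons x w ih => simp only [Word.map, ih]; rfl

theorem GradedQuiver.Word.map_map {k : Type u} [CommRing k] {A B C : GradedQuiver k}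
    (f : A.Obj → B.Obj) (f₁ : ∀ (X Y : A.Obj) (p : ℤ), A.Hom X Y p →ₗ[k] B.Hom (f X) (f Y) p)
    (g : B.Obj → C.Obj) (g₁ : ∀ (X Y : B.Obj) (p : ℤ), B.Hom X Y p →ₗ[k] C.Hom (g X) (g Y) p)
    {X Y : A.Obj} (w : A.Word X Y) :
    w.map (B := C) (fun X => g (f X)) (fun X Y p => (g₁ (f X) (f Y) p).comp (f₁ X Y p)) =
      (w.map f f₁).map g g₁ := by
  induction w with
  | single x => rfl
  | cons x w ih => simp only [Word.map, ih]; rfl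

theorem AInfData.bWord_congr {k : Type u} [CommRing k] (A : AInfData k) {X Y : A.Obj}
    {w w' : A.Word X Y} (e : w = w') (q : ℤ) (h : w.sdeg + 1 = q - 1) :
    A.bWord w q h = A.bWord w' q (e ▸ h) := by
  subst e; rfl

/-- The category of A∞-categories and strict A∞-functors. -/
instance AInfCategory.strictCategory (k : Type u) [CommRing k] : Category (AInfCategory k) where
  Hom A B := StrictFunctor A B
  id A := ⟨fun X => X, fun _ _ _ => LinearMap.id, fun _ _ w q _ =>
    A.bWord_congr w.map_id q _⟩
  comp {A B C} f g := ⟨fun X => g.obj (f.obj X),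
    fun X Y p => (g.map (f.obj X) (f.obj Y) p).comp (f.map X Y p), fun X Y w q h => by
      have h' : (w.map f.obj f.map).sdeg + 1 = q - 1 := by rw [GradedQuiver.Word.sdeg_map, h]
      rw [C.bWord_congr (w.map_map f.obj f.map g.obj g.map) q, g.comm _ _ _ _ h',
        f.comm _ _ _ _ h]
      rfl⟩

/-- The map `m₁ : A(X, Y)^p → A(X, Y)^q`, `q = p + 1`. Since `s b₁ = m₁ s`, it coincides with `b₁`
on elements. -/
def AInfData.m₁ {k : Type u} [CommRing k] (A : AInfData k) (X Y : A.Obj) (p q : ℤ)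
    (h : p + 1 = q) : A.Hom X Y p →ₗ[k] A.Hom X Y q :=
  A.b (DegPath.single p : DegPath A.Obj X Y) q (by simp only [DegPath.sdeg]; omega)

/-- The complex `(A(X, Y), m₁)`. -/
def AInfCategory.homComplex {k : Type u} [CommRing k] (A : AInfCategory k) (X Y : A.Obj) :
    CochainComplex (ModuleCat.{u} k) ℤ where
  X p := A.Hom X Y p
  d p q := if h : p + 1 = q then ModuleCat.ofHom (A.m₁ X Y p q h) else 0
  shape p q h := dif_neg h
  d_comp_d' p q r h₁ h₂ := by
    simp only [ComplexShape.up_Rel] at h₁ h₂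
    obtain rfl : q = (p - 1) + 2 := by omega
    obtain rfl : r = ((p - 1) + 2 - 1) + 2 := by omega
    rw [dif_pos h₁, dif_pos h₂]
    ext x
    have := A.isAInf X Y (.single (p := p) x)
    simp only [AInfData.bSum, AInfData.headSum, GradedQuiver.Word.splitSum, add_zero] at this
    have h0 := DirectSum.of_injective (β := fun q => A.Hom X Y q) _ (this.trans (map_zero _).symm)
    exact h0

/-- The forgetful functor `A ↦ (A, m₁)`. -/
def forgetU (k : Type u) [CommRing k] : AInfCategory k ⥤ DGQuiver k where
  obj A := ⟨A.Obj, A.homComplex⟩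
  map {A B} f := ⟨f.obj, fun X Y =>
    { f := fun p => ModuleCat.ofHom (f.map X Y p)
      comm' := fun p q h => by
        simp only [ComplexShape.up_Rel] at h
        simp only [AInfCategory.homComplex, dif_pos h]
        ext x
        exact f.comm X Y (.single (p := p) x) q
          (by simp only [GradedQuiver.Word.sdeg, GradedQuiver.Word.shape, DegPath.sdeg]; omega) }⟩

/-! ### Plane rooted trees -/

/-- Plane rooted trees (up to isomorphism). `leaf` is the tree `1` with one input vertex and no
internal vertex; `node [t₁, …, tₖ]` is `(t₁ ⊔ ⋯ ⊔ tₖ) · 𝔱ₖ`, whose lowest internal vertex carries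
`t₁, …, tₖ` from left to right. A list of trees is a forest. -/
inductive PTree : Type
  | leaf : PTree
  | node (ts : List PTree) : PTree

namespace PTree

mutual
/-- The number `n` of input vertices (there are `n + 1` external vertices, the root included). -/
def leaves : PTree → ℕ
  | leaf => 1
  | node ts => forestLeaves ts
/-- The number of input vertices of a forest. -/
def forestLeaves : List PTree → ℕ
  | [] => 0
  | t :: ts => t.leaves + forestLeaves ts
end

mutual
/-- The number `|t|` of internal vertices. -/
def internal : PTree → ℕ
  | leaf => 0
  | node ts => forestInternal ts + 1
/-- The number of internal vertices of a forest. -/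
def forestInternal : List PTree → ℕ
  | [] => 0
  | t :: ts => t.internal + forestInternal ts
end

mutual
/-- Every internal vertex is adjacent to at least `3` edges (at least `2` of them incoming). -/
def Reduced : PTree → Prop
  | leaf => True
  | node ts => 2 ≤ ts.length ∧ ForestReduced ts
/-- All trees of the forest are reduced. -/
def ForestReduced : List PTree → Prop
  | [] => True
  | t :: ts => t.Reduced ∧ ForestReduced ts
end

/-- All presentations `ts = u ++ v ++ z` with `2 ≤ length v < length ts`. -/
def groupings (ts : List PTree) : List (List PTree × List PTree × List PTree) :=
  (List.range (ts.length + 1)).flatMap fun r =>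
    ((List.range ts.length).filter fun n => 2 ≤ n ∧ r + n ≤ ts.length).map fun n =>
      (ts.take r, (ts.drop r).take n, ts.drop (r + n))

mutual
/-- The list of all pairs `(t', h)`, where `t'` is a reduced tree with a distinguished internal
edge `e` whose contraction gives the (reduced) tree `t`, and `h` is the height of the highest
vertex of `e`, that is, its position in the ordering of `IV(t')` in which a vertex precedes the
vertices above it and, of two incomparable vertices, the left one precedes the right one; the
lowest vertex has height `1`. Such a `t'` arises by moving at least two, but not all, consecutive
branches of some internal vertex of `t` onto a new vertex, joined to the old one by the new edge.
Either this is done at the lowest vertex of `t`, and the branches to the left of the new vertex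
precede it, or it is done inside one of the branches. -/
def expand : PTree → List (PTree × ℕ)
  | leaf => []
  | node ts =>
      ((groupings ts).map fun g =>
        (node (g.1 ++ node g.2.1 :: g.2.2), 1 + forestInternal g.1 + 1)) ++
      ((expandForest ts).map fun i => (node i.1, 1 + i.2))
/-- The same for forests. -/
def expandForest : List PTree → List (List PTree × ℕ)
  | [] => []
  | t :: ts =>
      (t.expand.map fun i => (i.1 :: ts, i.2)) ++
      ((expandForest ts).map fun i => (t :: i.1, t.internal + i.2))
end

end PTree

/-! ### Tensor algebra along paths -/

namespace GradedQuiver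

variable {k : Type u} [CommRing k] (A : GradedQuiver k)

/-- `T^{≥ 1}A(X, Y)`, the direct sum of all `A(X₀, X₁)^{p₁} ⊗ ⋯ ⊗ A(Xₙ₋₁, Xₙ)^{pₙ}`. -/
abbrev Total (X Y : A.Obj) : Type u := ⨁ w : DegPath A.Obj X Y, A.tensor w

/-- The isomorphism `(x₁ ⊗ ⋯ ⊗ xₘ) ⊗ (y₁ ⊗ ⋯ ⊗ yₙ) ↦ x₁ ⊗ ⋯ ⊗ xₘ ⊗ y₁ ⊗ ⋯ ⊗ yₙ`. -/
def mulTensor : {X Z Y : A.Obj} → (w : DegPath A.Obj X Z) → (w' : DegPath A.Obj Z Y) →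
    (A.tensor w ⊗[k] A.tensor w' →ₗ[k] A.tensor (w.append w'))
  | _, _, _, .single _, _ => LinearMap.id
  | X, _, _, @DegPath.cons _ _ Z _ p w, w' =>
      (LinearMap.lTensor (A.Hom X Z p) (mulTensor w w')).comp
        (TensorProduct.assoc k (A.Hom X Z p) (A.tensor w) (A.tensor w')).toLinearMap

open Classical in
/-- `x ⊗ (y₁ ⊗ ⋯ ⊗ yₙ) ↦ x ⊗ y₁ ⊗ ⋯ ⊗ yₙ`. -/
def consTotal {X Z Y : A.Obj} (p : ℤ) : A.Hom X Z p ⊗[k] A.Total Z Y →ₗ[k] A.Total X Y :=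
  TensorProduct.lift (LinearMap.flip (DirectSum.toModule k _ _ fun w =>
    LinearMap.flip ((TensorProduct.mk k (A.Hom X Z p) (A.tensor w)).compr₂
      (DirectSum.lof k _ (fun w' : DegPath A.Obj X Y => A.tensor w') (DegPath.cons p w)))))

end GradedQuiver

/-! ### The free A∞-category -/

section Free

variable {k : Type u} [CommRing k] (Q : DGQuiver k)

open Classical in
/-- The differential `d ⊗ 1 ⊗ ⋯ ⊗ 1 + ⋯ + 1 ⊗ ⋯ ⊗ 1 ⊗ d` of `TⁿsQ`, where
`d : sQ → sQ` is the differential of `Q` on elements (`s d_{sQ} = d_Q s`). Operators act on the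
right, so that `d` at the `i`-th place comes with the sign `(-1)` to the power of the total degree
in `sQ` of the factors to the right of the `i`-th one. -/
def tensorD : {X Y : Q.Obj} → (w : DegPath Q.Obj X Y) →
    (Q.toGraded.tensor w →ₗ[k] Q.toGraded.Total X Y)
  | X, Y, .single p =>
      (DirectSum.lof k _ (fun w' : DegPath Q.Obj X Y => Q.toGraded.tensor w')
        (DegPath.single (p + 1))).comp ((Q.Hom X Y).d p (p + 1)).hom
  | X, Y, @DegPath.cons _ _ Z _ p w =>
      (w.sdeg.negOnePow •
        ((DirectSum.lof k _ (fun w' : DegPath Q.Obj X Y => Q.toGraded.tensor w')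
          (DegPath.cons (p + 1) w)).comp
          (LinearMap.rTensor (Q.toGraded.tensor w) ((Q.Hom X Z).d p (p + 1)).hom)) +
      (Q.toGraded.consTotal p).comp (LinearMap.lTensor (Q.toGraded.Hom X Z p) (tensorD w)) :
        Q.toGraded.Hom X Z p ⊗[k] Q.toGraded.tensor w →ₗ[k] Q.toGraded.Total X Y)

/-- The index set of the summands `sQ(X₀, X₁)^{p₁ - 1} ⊗ ⋯ ⊗ sQ(Xₙ₋₁, Xₙ)^{pₙ - 1}` of
`sFQ(X, Y)^{q - 1} = FQ(X, Y)^q`: pairs `(t, w)` of a reduced tree `t` with `n` input vertices and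
a path `w = (X₀, p₁, X₁, …, pₙ, Xₙ)` from `X` to `Y`. The shift `[-|t|]` raises degrees by `|t|`. -/
def FreeIndex (O : Type u) (X Y : O) (q : ℤ) : Type u :=
  {i : PTree × DegPath O X Y //
    i.1.Reduced ∧ i.1.leaves = i.2.length ∧ i.2.sdeg + (i.1.internal : ℤ) = q - 1}

/-- The graded quiver `FQ`. -/
def freeGraded : GradedQuiver k where
  Obj := Q.Obj
  Hom X Y q := ModuleCat.of k (⨁ i : FreeIndex Q.Obj X Y q, Q.toGraded.tensor i.1.2)

open Classical in
/-- The inclusion of the summand of `FQ(X, Y)^q` indexed by `(t, w)` (and `0` if `(t, w)` does not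
index a summand of it, which does not occur below). -/
def freeι {X Y : Q.Obj} (q : ℤ) (t : PTree) (w : DegPath Q.Obj X Y) :
    Q.toGraded.tensor w →ₗ[k] (freeGraded Q).Hom X Y q :=
  if h : t.Reduced ∧ t.leaves = w.length ∧ w.sdeg + (t.internal : ℤ) = q - 1 then
    DirectSum.lof k _ (fun i : FreeIndex Q.Obj X Y q => Q.toGraded.tensor i.1.2) ⟨(t, w), h⟩
  else 0

open Classical in
/-- The operation `b₁` of `FQ`. On the summand of the tree `t` it is the sum of the differential
of `TⁿsQ[-|t|]`, which is `(-1)^{|t|}` times that of `TⁿsQ` on elements, and of the maps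
`(-1)^{β(t')} s⁻¹ : sF_tQ → sF_{t'}Q`, `β(t') = 1 + h`, over all trees `t'` with a distinguished
edge whose contraction gives `t`; the map `s⁻¹ = 1 ⊗ ⋯ ⊗ 1 ⊗ s⁻¹` is the identity on elements. -/
def freeB₁ {X Y : Q.Obj} (p q : ℤ) :
    (freeGraded Q).Hom X Y p →ₗ[k] (freeGraded Q).Hom X Y q :=
  DirectSum.toModule k _ _ fun i : FreeIndex Q.Obj X Y p =>
    (i.1.1.internal : ℤ).negOnePow •
      ((DirectSum.toModule k _ _ fun w' => freeι Q q i.1.1 w').comp (tensorD Q i.1.2)) +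
    (i.1.1.expand.map fun e => ((1 + e.2 : ℕ) : ℤ).negOnePow • freeι Q q e.1 i.1.2).sum

open Classical in
/-- For `x₁ ⊗ ⋯ ⊗ xₙ` with `xᵢ` in the summand of the tree `tᵢ`, this is
`(x₁ ⊗ ⋯ ⊗ xₙ)(s^{|t₁|} ⊗ ⋯ ⊗ s^{|tₙ|})`, an element of `T sQ` placed in the summand of the forest
`t₁, …, tₙ`. Moving `s^{|tᵢ|}` past `xᵢ₊₁, …, xₙ` gives the sign `(-1)` to the power of `|tᵢ|`
times their total degree in `sFQ`. -/
def freeConcat : {X Y : Q.Obj} → (W : DegPath Q.Obj X Y) →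
    ((freeGraded Q).tensor W →ₗ[k]
      ⨁ i : List PTree × DegPath Q.Obj X Y, Q.toGraded.tensor i.2)
  | X, Y, .single p =>
      DirectSum.toModule k _ _ fun i : FreeIndex Q.Obj X Y p =>
        DirectSum.lof k _ (fun i : List PTree × DegPath Q.Obj X Y => Q.toGraded.tensor i.2)
          ([i.1.1], i.1.2)
  | X, Y, @DegPath.cons _ _ Z _ p W =>
      TensorProduct.lift (LinearMap.compl₂
        (DirectSum.toModule k _ _ fun i : FreeIndex Q.Obj X Z p =>
          LinearMap.flip (DirectSum.toModule k _ _
            fun j : List PTree × DegPath Q.Obj Z Y =>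
              LinearMap.flip ((TensorProduct.mk k (Q.toGraded.tensor i.1.2)
                (Q.toGraded.tensor j.2)).compr₂
                (((i.1.1.internal : ℤ) * W.sdeg).negOnePow •
                  (DirectSum.lof k _
                    (fun i : List PTree × DegPath Q.Obj X Y => Q.toGraded.tensor i.2)
                    (i.1.1 :: j.1, i.1.2.append j.2)).comp
                  (Q.toGraded.mulTensor i.1.2 j.2)))))
        (freeConcat W))

open Classical in
/-- The free A∞-category `FQ`, as a graded quiver with operations. For `n > 1` the operation
`bₙ` maps `sF_{t₁}Q ⊗ ⋯ ⊗ sF_{tₙ}Q` to `sF_tQ` by `s^{|t₁|} ⊗ ⋯ ⊗ s^{|tₙ₋₁|} ⊗ s^{|tₙ| - |t|}`,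
where `t = (t₁ ⊔ ⋯ ⊔ tₙ) · 𝔱ₙ`. -/
def freeAInf : AInfData k where
  toGradedQuiver := freeGraded Q
  b {X Y} W q _ := match W with
    | .single p => freeB₁ Q p q
    | .cons p W' =>
        (DirectSum.toModule k _ _ fun i : List PTree × DegPath Q.Obj X Y =>
          freeι Q q (PTree.node i.1) i.2).comp (freeConcat Q (DegPath.cons p W'))

/-- The inclusion `Q(X, Y)^p → FQ(X, Y)^p` of the summand of the tree without internal vertices. -/
def freeLeaf (X Y : Q.Obj) (p : ℤ) : (Q.Hom X Y).X p →ₗ[k] (freeGraded Q).Hom X Y p :=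
  freeι Q p PTree.leaf (DegPath.single p : DegPath Q.Obj X Y)

open Classical in
theorem freeB₁_freeLeaf (X Y : Q.Obj) (p : ℤ) (x : (Q.Hom X Y).X p) :
    freeB₁ Q p (p + 1) (freeLeaf Q X Y p x) =
      freeLeaf Q X Y (p + 1) ((Q.Hom X Y).d p (p + 1) x) := by
  have hp : PTree.leaf.Reduced ∧
      PTree.leaf.leaves = (DegPath.single p : DegPath Q.Obj X Y).length ∧
      (DegPath.single p : DegPath Q.Obj X Y).sdeg + (PTree.leaf.internal : ℤ) = p - 1 := by
    simp [PTree.Reduced, PTree.leaves, PTree.internal, DegPath.length, DegPath.sdeg]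
  have e : freeι Q p PTree.leaf (DegPath.single p : DegPath Q.Obj X Y) = DirectSum.lof k _
      (fun i : FreeIndex Q.Obj X Y p => Q.toGraded.tensor i.1.2) ⟨(PTree.leaf, DegPath.single p), hp⟩ :=
    dif_pos hp
  rw [freeLeaf, e, freeB₁]
  erw [DirectSum.toModule_lof]
  simp only [PTree.expand, PTree.internal, tensorD, List.map_nil, List.sum_nil, add_zero,
    Nat.cast_zero, Int.negOnePow_zero, one_smul]
  erw [DirectSum.toModule_lof]
  rfl

/-- The inclusion `Q → (FQ, m₁)` onto the summand of the tree without internal vertices. -/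
def freeIncl (h : (freeAInf Q).IsAInf) : Q ⟶ (forgetU k).obj ⟨freeAInf Q, h⟩ where
  obj X := X
  map X Y :=
    { f := fun p => ModuleCat.ofHom (freeLeaf Q X Y p)
      comm' := fun p q hpq => by
        simp only [ComplexShape.up_Rel] at hpq
        subst hpq
        simp only [forgetU, AInfCategory.homComplex, dif_pos]
        ext x
        exact freeB₁_freeLeaf Q X Y p x }

end Free

end AInf

end

-- A word in `FQ` whose letters lie in the summands of trees t₁, …, tₙ is, up to the Koszul sign
-- `TreeWord.sgn` of s^{|t₁|} ⊗ ⋯ ⊗ s^{|tₙ|}, a pair: the forest t₁, …, tₙ and an element of the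
-- tensor algebra of `sQ`. Once this sign is stripped, the operator ∑ 1^{⊗ r} ⊗ bₙ ⊗ 1^{⊗ t} becomes
-- D + c up to signs (`TreeWord.bSum_word`). Here D is the differential of the tensor algebra and
-- leaves the forest alone. The coderivation c (`coder`) changes only the forest: it grafts a run of
-- at least two neighbouring trees onto a new root, or replaces one tree by minus the signed sum of
-- its expansions.
--
-- The A∞-equations therefore split into three. D² = 0 is the Leibniz rule (`totalD_totalD`). The
-- mixed terms cancel because c adds exactly one internal vertex and so anticommutes with the sign
-- (-1)^{|t|} (`PTree.corolla_sign_smul`). What remains is that the components of c² vanish, which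
-- is pure combinatorics of trees. On a forest of two or more trees this is the recursive
-- description of expansions: an expansion of `node ts` either gathers some, but not all,
-- consecutive branches, or expands one branch (`PTree.expandSum_node`). On a single tree it says
-- that the signed sum of double expansions is zero (`PTree.expandSum_expandSum`). By
-- `PTree.expandSum_node` the double expansion of `node ts` is c² on the forest `ts`, followed by
-- grafting; the square of an odd coderivation vanishes if its components do (`PTree.coder_coder`),
-- and the components on single branches vanish by induction on the tree.
--
-- For the universal property, the value of an extension on a grafted tree is forced: it is bₙ of
-- the values on the branches, with the sign `TreeWord.sgn` undone (`evalForest`). Compatibility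
-- with bₙ for n ≥ 2 then holds by construction. Compatibility with b₁ holds on `Q`, where a chain
-- map is given; it passes to sums, and also to values of bₙ, because the A∞-equations in source and
-- target express bₙ followed by b₁ through the other operations (`AInfData.commutes_single_bWord`).
-- Since `Q` generates `FQ` under sums and the bₙ with n ≥ 2 (`freeAInf_induction`), this gives
-- existence, and the same induction gives uniqueness. The resulting bijection is natural in the
-- target, hence defines the left adjoint, and the unit is the image of the identity.

noncomputable section

namespace AInf

namespace PTree

/-! ### Signed sums over expansions of trees and forests -/

section Combinatorics

variable {N N' : Type*} [AddCommGroup N] [AddCommGroup N']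

/-- The sum of `K v z` over all ways to write a list as `v ++ z`. -/
def cutSum (K : List PTree → List PTree → N) : List PTree → N
  | [] => K [] []
  | t :: ts => K [] (t :: ts) + cutSum (fun v z => K (t :: v) z) ts

theorem cutSum_add (K K' : List PTree → List PTree → N) (ts : List PTree) :
    cutSum (fun v z => K v z + K' v z) ts = cutSum K ts + cutSum K' ts := by
  induction ts generalizing K K' with
  | nil => rfl
  | cons t ts ih => simp only [cutSum, ih]; abel

theorem cutSum_map (L : N →+ N') (K : List PTree → List PTree → N) (ts : List PTree) :
    cutSum (fun v z => L (K v z)) ts = L (cutSum K ts) := by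
  induction ts generalizing K with
  | nil => rfl
  | cons t ts ih => simp only [cutSum, ih, map_add]

theorem cutSum_smul (c : ℤˣ) (K : List PTree → List PTree → N) (ts : List PTree) :
    cutSum (fun v z => c • K v z) ts = c • cutSum K ts :=
  cutSum_map (DistribSMul.toAddMonoidHom N c) K ts

theorem cutSum_congr {K K' : List PTree → List PTree → N} {ts : List PTree}
    (h : ∀ v z, v ++ z = ts → K v z = K' v z) : cutSum K ts = cutSum K' ts := by
  induction ts generalizing K K' with
  | nil => exact h [] [] rfl
  | cons t ts ih =>
    simp only [cutSum]
    rw [h [] _ rfl, ih fun v z e => h (t :: v) z (by simp [e])]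

theorem cutSum_eq_zero {K : List PTree → List PTree → N} {ts : List PTree}
    (h : ∀ v z, v ++ z = ts → K v z = 0) : cutSum K ts = 0 := by
  rw [cutSum_congr h]
  simpa using cutSum_map (0 : N →+ N) (fun _ _ => 0) ts

theorem cutSum_zero (ts : List PTree) : cutSum (fun _ _ => (0 : N)) ts = 0 :=
  cutSum_eq_zero fun _ _ _ => rfl

/-- Coassociativity of deconcatenation: both sides run over all ways to cut the list into three
pieces. -/
theorem cutSum_cutSum (M : List PTree → List PTree → List PTree → N) (ts : List PTree) :
    cutSum (fun v z => cutSum (fun a b => M v a b) z) ts =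
      cutSum (fun y b => cutSum (fun v a => M v a b) y) ts := by
  induction ts generalizing M with
  | nil => rfl
  | cons t ts ih =>
    simp only [cutSum, cutSum_add, ih fun v a b => M (t :: v) a b]
    abel

theorem cutSum_eq_sum (K : List PTree → List PTree → N) (ts : List PTree) :
    cutSum K ts = ∑ n ∈ Finset.range (ts.length + 1), K (ts.take n) (ts.drop n) := by
  induction ts generalizing K with
  | nil => simp [cutSum]
  | cons t ts ih =>
    rw [List.length_cons, Finset.sum_range_succ', cutSum, ih]
    simp [add_comm]

/-- The sign `(-1)^{|t|}`. -/
def sign (t : PTree) : ℤˣ := (t.internal : ℤ).negOnePow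

/-- The sign `(-1)^{|t₁| + ⋯ + |tₙ|}`. -/
def forestSign (ts : List PTree) : ℤˣ := (forestInternal ts : ℤ).negOnePow

@[simp] theorem forestSign_nil : forestSign [] = 1 := by simp [forestSign, forestInternal]

@[simp] theorem forestSign_cons (t : PTree) (ts : List PTree) :
    forestSign (t :: ts) = t.sign * forestSign ts := by
  simp [forestSign, forestInternal, sign, Int.negOnePow_add]

/-- The sum of `(-1)^h φ t'` over all expansions `(t', h)` of `t`. -/
def expandSum (φ : PTree → N) (t : PTree) : N :=
  (t.expand.map fun e => (e.2 : ℤ).negOnePow • φ e.1).sum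

/-- The sum of `(-1)^h f ts'` over all expansions `(ts', h)` of a forest. -/
def forestExpandSum (f : List PTree → N) (ts : List PTree) : N :=
  ((expandForest ts).map fun e => (e.2 : ℤ).negOnePow • f e.1).sum

theorem expandSum_map (L : N →+ N') (φ : PTree → N) (t : PTree) :
    expandSum (fun s => L (φ s)) t = L (expandSum φ t) := by
  simp only [expandSum, map_list_sum, List.map_map]
  congr 1
  refine List.map_congr_left fun e _ => ?_
  simp [Units.smul_def]

theorem expandSum_congr {φ ψ : PTree → N} {t : PTree} (h : ∀ e ∈ t.expand, φ e.1 = ψ e.1) :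
    expandSum φ t = expandSum ψ t := by
  unfold expandSum
  congr 1
  exact List.map_congr_left fun e he => by rw [h e he]

theorem expandSum_add (φ ψ : PTree → N) (t : PTree) :
    expandSum (fun s => φ s + ψ s) t = expandSum φ t + expandSum ψ t := by
  simp [expandSum, List.sum_map_add]

theorem expandSum_smul (c : ℤˣ) (φ : PTree → N) (t : PTree) :
    expandSum (fun s => c • φ s) t = c • expandSum φ t :=
  expandSum_map (DistribSMul.toAddMonoidHom N c) φ t

theorem forestExpandSum_nil (f : List PTree → N) : forestExpandSum f [] = 0 := by
  simp [forestExpandSum, expandForest]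

/-- The sign of `t` appears because the vertices of `t` precede those of `ts`, so heights in `ts`
are shifted by |t|. This is the Leibniz rule for expansion. -/
theorem forestExpandSum_cons (f : List PTree → N) (t : PTree) (ts : List PTree) :
    forestExpandSum f (t :: ts) =
      expandSum (fun s => f (s :: ts)) t + t.sign • forestExpandSum (fun us => f (t :: us)) ts := by
  simp only [forestExpandSum, expandForest, List.map_append, List.map_map, List.sum_append,
    expandSum, sign]
  congr 1
  rw [List.smul_sum, List.map_map]
  congr 1
  refine List.map_congr_left fun e _ => ?_
  simp [Int.negOnePow_add, mul_smul]

/-- The structure constants of the operations: `[t]` goes to minus its signed expansions, and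
`v` with at least two trees to `node v`. -/
def corolla (φ : PTree → N) : List PTree → N
  | [] => 0
  | [t] => -expandSum φ t
  | t :: s :: ts => φ (node (t :: s :: ts))

@[simp] theorem corolla_nil (φ : PTree → N) : corolla φ [] = 0 := rfl

theorem corolla_add (φ ψ : PTree → N) (v : List PTree) :
    corolla (fun s => φ s + ψ s) v = corolla φ v + corolla ψ v := by
  match v with
  | [] => simp [corolla]
  | [t] => simp only [corolla, expandSum_add]; abel
  | t :: s :: ts => rfl

theorem corolla_map (L : N →+ N') (φ : PTree → N) (v : List PTree) :
    corolla (fun s => L (φ s)) v = L (corolla φ v) := by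
  match v with
  | [] => simp [corolla]
  | [t] => simp only [corolla, expandSum_map, map_neg]
  | t :: s :: ts => rfl

/-- The coderivation with components `corolla`, evaluated on a function of forests. -/
def coder (f : List PTree → N) : List PTree → N
  | [] => 0
  | t :: ts => cutSum (fun v z => corolla (fun s => f (s :: z)) v) (t :: ts) +
      t.sign • coder (fun us => f (t :: us)) ts

theorem coder_add (f g : List PTree → N) (ts : List PTree) :
    coder (fun us => f us + g us) ts = coder f ts + coder g ts := by
  induction ts generalizing f g with
  | nil => simp [coder]
  | cons t ts ih =>
    simp only [coder, corolla_add, cutSum_add, ih, smul_add]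
    abel

theorem coder_map (L : N →+ N') (f : List PTree → N) (ts : List PTree) :
    coder (fun us => L (f us)) ts = L (coder f ts) := by
  induction ts generalizing f with
  | nil => simp [coder]
  | cons t ts ih =>
    simp only [coder, corolla_map L, cutSum_map L, ih, map_add]
    simp [Units.smul_def]

theorem coder_smul (c : ℤˣ) (f : List PTree → N) (ts : List PTree) :
    coder (fun us => c • f us) ts = c • coder f ts :=
  coder_map (DistribSMul.toAddMonoidHom N c) f ts

theorem coder_congr {f g : List PTree → N} {ts : List PTree}
    (h : ∀ us, us ≠ [] → f us = g us) : coder f ts = coder g ts := by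
  induction ts generalizing f g with
  | nil => rfl
  | cons t ts ih =>
    simp only [coder]
    rw [ih fun us _ => h (t :: us) (by simp)]
    congr 2
    funext v z
    congr 1
    funext s
    exact h _ (by simp)

theorem coder_zero (ts : List PTree) : coder (fun _ => (0 : N)) ts = 0 := by
  simpa using coder_map (0 : N →+ N) (fun _ => 0) ts

theorem corolla_smul (c : ℤˣ) (φ : PTree → N) (v : List PTree) :
    corolla (fun s => c • φ s) v = c • corolla φ v :=
  corolla_map (DistribSMul.toAddMonoidHom N c) φ v

/-- `corolla v`, as a homomorphism. -/
def corollaHom (v : List PTree) : (PTree → N) →+ N where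
  toFun φ := corolla φ v
  map_zero' := by simpa using! corolla_map (0 : N →+ N) (fun _ => 0) v
  map_add' φ ψ := corolla_add φ ψ v

/-- The two operators act on separate arguments of `f` and are both additive, so they may be
interchanged; no sign arises, as these are sums of values and not composites of odd maps. -/
theorem coder_corolla_comm (f : PTree → List PTree → N) (v ts : List PTree) :
    coder (fun us => corolla (fun s => f s us) v) ts =
      corolla (fun s => coder (f s) ts) v := by
  refine (coder_map (corollaHom v) (fun us s => f s us) ts).trans ?_
  simp only [corollaHom, AddMonoidHom.coe_mk, ZeroHom.coe_mk]
  congr 1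
  funext s
  exact (coder_map (Pi.evalAddMonoidHom (fun _ : PTree => N) s) (fun us s => f s us) ts).symm

theorem corolla_cutSum_comm (K : PTree → List PTree → List PTree → N) (v ts : List PTree) :
    corolla (fun s => cutSum (K s) ts) v = cutSum (fun a b => corolla (fun s => K s a b) v) ts := by
  refine Eq.trans ?_ (cutSum_map (corollaHom v) (fun a b s => K s a b) ts).symm
  simp only [corollaHom, AddMonoidHom.coe_mk, ZeroHom.coe_mk]
  congr 1
  funext s
  exact cutSum_map (Pi.evalAddMonoidHom (fun _ : PTree => N) s) (fun a b s => K s a b) ts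

/-- The coderivation property: `cutSum` plays the role of the coproduct, and an operation performed
before cutting takes place either in the left piece or, with the sign of passing the left piece, in
the right one. -/
theorem coder_cutSum (K : List PTree → List PTree → N) (ts : List PTree) :
    coder (cutSum K) ts =
      cutSum (fun v z => coder (fun us => K us z) v + forestSign v • coder (K v) z) ts := by
  induction ts generalizing K with
  | nil => simp [coder, cutSum]
  | cons t ts ih =>
    -- Cutting after a prefix has been collapsed to `s`: the cut in front of `s` gives the empty
    -- left piece and is counted apart; the other cuts are regrouped by coassociativity.
    have h1 : cutSum (fun v z => corolla (fun s => cutSum (fun v' z => K (s :: v') z) z) v)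
        (t :: ts) = cutSum (fun v z => cutSum (fun y a =>
          corolla (fun s => K (s :: a) z) y) (t :: v)) ts := by
      simp only [corolla_cutSum_comm]
      rw [cutSum_cutSum (fun v a b => corolla (fun s => K (s :: a) b) v)]
      rw [cutSum]
      simp [cutSum, corolla]
    have h2 := ih fun v z => K (t :: v) z
    simp only [coder, cutSum, forestSign_cons, corolla_add, cutSum_add, coder_add, mul_smul,
      cutSum_smul, smul_add, forestSign_nil, one_smul, corolla_nil, zero_add] at h1 h2 ⊢
    simp only [h1, h2, smul_add]
    abel

/-- The operation taking `v` to `node v`, if `v` consists of at least two trees. -/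
def branch (φ : PTree → N) (v : List PTree) : N := if 2 ≤ v.length then φ (node v) else 0

/-- The value of `ψ` at the only tree of a forest. -/
def only (ψ : PTree → N) : List PTree → N
  | [t] => ψ t
  | _ => 0

theorem corolla_eq (φ : PTree → N) (v : List PTree) :
    corolla φ v = branch φ v - only (expandSum φ) v := by
  match v with
  | [] => simp [corolla, branch, only]
  | [t] => simp [corolla, branch, only]
  | t :: s :: ts => simp [corolla, branch, only]

/-- Projecting a coderivation to forests with one tree recovers its components: only the collapse of
the whole forest survives. -/
theorem coder_only (ψ : PTree → N) (ts : List PTree) : coder (only ψ) ts = corolla ψ ts := by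
  match ts with
  | [] => simp [coder, corolla]
  | t :: ts =>
    have h0 : coder (fun us => only ψ (t :: us)) ts = 0 := by
      rw [← coder_zero (N := N) ts]
      refine coder_congr fun us hus => ?_
      match us, hus with
      | s :: us, _ => rfl
    rw [coder, h0, smul_zero, add_zero]
    have : ∀ (ts : List PTree) (v₀ : List PTree), cutSum (fun v z => corolla (fun s =>
        only ψ (s :: z)) (v₀ ++ v)) ts = corolla ψ (v₀ ++ ts) := by
      intro ts
      induction ts with
      | nil => intro v₀; simp [cutSum, only]
      | cons t ts ih =>
        intro v₀
        have := ih (v₀ ++ [t])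
        simp only [List.append_assoc, List.singleton_append] at this
        rw [cutSum, this]
        simp only [only]
        rw [show corolla (fun _ => (0 : N)) (v₀ ++ []) = 0 from (corollaHom (v₀ ++ [])).map_zero,
          zero_add]
    simpa using this (t :: ts) []

theorem coder_branch_of_length_lt (φ : PTree → N) (ts : List PTree) (h : ts.length < 2) :
    coder (branch φ) ts = 0 := by
  match ts with
  | [] => rfl
  | [t] =>
    simp only [coder, cutSum, corolla, branch, List.length_cons, List.length_nil]
    simpa [corolla] using! congrArg Neg.neg (expandSum_map (0 : N →+ N) (fun _ => 0) t)
  | _ :: _ :: _ => simp at h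

-- Vertices, leaves and reducedness under grafting and expansion

theorem internal_node (ts : List PTree) : (node ts).internal = forestInternal ts + 1 := by
  simp [internal]

theorem forestInternal_append (ts us : List PTree) :
    forestInternal (ts ++ us) = forestInternal ts + forestInternal us := by
  induction ts with
  | nil => simp [forestInternal]
  | cons t ts ih => simp [forestInternal, ih, add_assoc]

theorem forestLeaves_append (ts us : List PTree) :
    forestLeaves (ts ++ us) = forestLeaves ts + forestLeaves us := by
  induction ts with
  | nil => simp [forestLeaves]
  | cons t ts ih => simp [forestLeaves, ih, add_assoc]

theorem forestReduced_append (ts us : List PTree) :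
    ForestReduced (ts ++ us) ↔ ForestReduced ts ∧ ForestReduced us := by
  induction ts with
  | nil => simp [ForestReduced]
  | cons t ts ih => simp [ForestReduced, ih, and_assoc]

theorem mem_groupings {ts : List PTree} {g : List PTree × List PTree × List PTree}
    (h : g ∈ groupings ts) :
    g.1 ++ g.2.1 ++ g.2.2 = ts ∧ 2 ≤ g.2.1.length ∧ g.2.1.length < ts.length := by
  simp only [groupings, List.mem_flatMap, List.mem_map, List.mem_filter, List.mem_range,
    decide_eq_true_eq] at h
  obtain ⟨r, hr, n, ⟨hn, h2, hrn⟩, rfl⟩ := h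
  refine ⟨?_, ?_, ?_⟩
  · simp only [List.append_assoc]
    rw [← List.drop_drop, List.take_append_drop, List.take_append_drop]
  · simp; omega
  · simp; omega

-- These facts guarantee that every expansion of a reduced tree again indexes a summand of `FQ`, in
-- degree one higher, and that the signed sums are homogeneous.
mutual
theorem expand_spec : ∀ (t : PTree) (e : PTree × ℕ), e ∈ t.expand →
    e.1.internal = t.internal + 1 ∧ e.1.leaves = t.leaves ∧ (t.Reduced → e.1.Reduced)
  | leaf, e, h => by simp [expand] at h
  | node ts, e, h => by
    simp only [expand, List.mem_append, List.mem_map] at h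
    rcases h with ⟨g, hg, rfl⟩ | ⟨i, hi, rfl⟩
    · obtain ⟨h1, h2, h3⟩ := mem_groupings hg
      have hl := congrArg List.length h1
      subst h1
      simp only [List.length_append] at hl h3
      simp only [internal, leaves, Reduced, forestInternal_append, forestLeaves_append,
        forestReduced_append, forestInternal, forestLeaves, ForestReduced, List.length_append,
        List.length_cons]
      refine ⟨by omega, by omega, fun h => ⟨by omega, ?_⟩⟩
      tauto
    · obtain ⟨h1, h2, h3, h4⟩ := expandForest_spec ts i hi
      simp only [internal, leaves, Reduced, h1, h2, h4]
      tauto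
theorem expandForest_spec : ∀ (ts : List PTree) (e : List PTree × ℕ), e ∈ expandForest ts →
    forestInternal e.1 = forestInternal ts + 1 ∧ forestLeaves e.1 = forestLeaves ts ∧
      (ForestReduced ts → ForestReduced e.1) ∧ e.1.length = ts.length
  | [], e, h => by simp [expandForest] at h
  | t :: ts, e, h => by
    simp only [expandForest, List.mem_append, List.mem_map] at h
    rcases h with ⟨i, hi, rfl⟩ | ⟨i, hi, rfl⟩
    · obtain ⟨h1, h2, h3⟩ := expand_spec t i hi
      simp only [forestInternal, forestLeaves, ForestReduced, List.length_cons, h1, h2]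
      exact ⟨by ring, trivial, fun h => ⟨h3 h.1, h.2⟩, trivial⟩
    · obtain ⟨h1, h2, h3, h4⟩ := expandForest_spec ts i hi
      simp only [forestInternal, forestLeaves, ForestReduced, List.length_cons, h1, h2, h4]
      exact ⟨by ring, trivial, fun h => ⟨h.1, h3 h.2⟩, trivial⟩
end

/-- Every tree produced from `v`, by grafting or by expansion, has one internal vertex more than
`v`, so a sign depending only on that number can be pulled out. -/
theorem corolla_negOnePow_smul (d : ℤ) (φ : PTree → N) (v : List PTree) :
    corolla (fun s => ((s.internal : ℤ) * d).negOnePow • φ s) v =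
      (((forestInternal v : ℤ) + 1) * d).negOnePow • corolla φ v := by
  match v with
  | [] => simp [corolla]
  | [t] =>
    rw [corolla, corolla, expandSum_congr (ψ := fun s => (((forestInternal [t] : ℤ) + 1) * d).negOnePow
      • φ s) fun e he => by rw [(expand_spec t e he).1]; simp [forestInternal]]
    rw [expandSum_smul]
    simp
  | t :: s :: ts => simp only [corolla, internal_node, Nat.cast_add, Nat.cast_one]

theorem corolla_sign_smul (φ : PTree → N) (v : List PTree) :
    corolla (fun s => s.sign • φ s) v = -(forestSign v • corolla φ v) := by
  simpa [sign, forestSign, Int.negOnePow_add, Units.neg_smul] using corolla_negOnePow_smul 1 φ v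

theorem corolla_of_two_le (φ : PTree → N) {v : List PTree} (h : 2 ≤ v.length) :
    corolla φ v = φ (node v) := by
  match v, h with
  | t :: s :: ts, _ => rfl

theorem only_of_two_le (ψ : PTree → N) {v : List PTree} (h : 2 ≤ v.length) : only ψ v = 0 := by
  match v, h with
  | t :: s :: ts, _ => rfl

/-- The square of `coder` is determined by its components, which are the values of
`coder (corolla φ)`. -/
theorem coder_coder (f : List PTree → N) (ts : List PTree) :
    (∀ (v u z : List PTree) (φ : PTree → N), u ++ v ++ z = ts → coder (corolla φ) v = 0) →
    coder (coder f) ts = 0 := by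
  induction ts generalizing f with
  | nil => intro; rfl
  | cons t ts ih =>
    intro h
    have hih := ih (fun us => f (t :: us)) fun v u z φ e => h v (t :: u) z φ (by simp [e])
    -- When both operations leave `t` untouched, the contribution is the square of `coder` on `ts`,
    -- which vanishes by induction.
    have h1 : coder (coder f) (t :: ts) =
        cutSum (fun v z => corolla (fun s => coder f (s :: z)) v) (t :: ts) +
          t.sign • coder (fun us => cutSum (fun v z => corolla (fun s => f (s :: z)) v)
            (t :: us)) ts := by
      conv_lhs => rw [coder]
      congr 2
      rw [show (fun us => coder f (t :: us)) = fun us =>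
        cutSum (fun v z => corolla (fun s => f (s :: z)) v) (t :: us) +
          t.sign • coder (fun us => f (t :: us)) us from rfl]
      rw [coder_add, coder_smul, hih, smul_zero, add_zero]
    -- The left side is `coder` of a deconcatenation sum, unfolded at `t`. By `coder_cutSum` the
    -- first operation happens inside `v` or inside `z`; inside `v` it gives a component of the
    -- square, zero by hypothesis.
    have h2 : cutSum (fun v z => corolla (fun s =>
          cutSum (fun v z => corolla (fun s => f (s :: z)) v) (s :: z)) v) (t :: ts) +
        t.sign • coder (fun us => cutSum (fun v z => corolla (fun s => f (s :: z)) v)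
            (t :: us)) ts =
        cutSum (fun v z => forestSign v •
          coder (fun z => corolla (fun s => f (s :: z)) v) z) (t :: ts) := by
      refine (coder_cutSum (fun v z => corolla (fun s => f (s :: z)) v) (t :: ts)).trans ?_
      refine cutSum_congr fun v z e => ?_
      rw [h v [] z (fun s => f (s :: z)) (by simpa using e), zero_add]
    -- If `v` is collapsed to `s` and the second operation lies to the right of `s`, the sign of `s`
    -- is opposite to that of `v`. These disjoint operations thus cancel those performed in the
    -- other order.
    have h3 : cutSum (fun v z => corolla (fun s => coder f (s :: z)) v) (t :: ts) =
        cutSum (fun v z => corolla (fun s =>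
          cutSum (fun v z => corolla (fun s => f (s :: z)) v) (s :: z)) v) (t :: ts) -
        cutSum (fun v z => forestSign v •
          coder (fun z => corolla (fun s => f (s :: z)) v) z) (t :: ts) := by
      rw [eq_sub_iff_add_eq, ← cutSum_add]
      refine cutSum_congr fun v z _ => ?_
      simp only [coder, corolla_add, corolla_sign_smul, coder_corolla_comm]
      abel
    rw [h1, h3, ← h2]
    abel

-- Groupings of branches and the recursion for expansions

theorem sum_map_filter_range (p : ℕ → Prop) [DecidablePred p] {α : Type*} (g : ℕ → α)
    (φ : α → N) (m : ℕ) :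
    ((((List.range m).filter fun n => p n).map g).map φ).sum =
      ∑ n ∈ Finset.range m, if p n then φ (g n) else 0 := by
  induction m with
  | zero => simp
  | succ m ih =>
    rw [List.range_succ, List.filter_append, List.map_append, List.map_append, List.sum_append,
      ih, Finset.sum_range_succ]
    by_cases h : p m <;> simp [h]

theorem sum_map_flatMap_range {α : Type*} (g : ℕ → List α) (φ : α → N) (m : ℕ) :
    (((List.range m).flatMap g).map φ).sum = ∑ r ∈ Finset.range m, ((g r).map φ).sum := by
  induction m with
  | zero => simp
  | succ m ih =>
    rw [List.range_succ, List.flatMap_append, List.map_append, List.sum_append, ih,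
      Finset.sum_range_succ]
    simp

/-- The sum over all presentations `ts = u ++ v ++ z` with `2 ≤ length v`. -/
def groupSum (φ : List PTree → List PTree → List PTree → N) : List PTree → N
  | [] => 0
  | t :: ts => cutSum (fun v z => if 2 ≤ v.length then φ [] v z else 0) (t :: ts) +
      groupSum (fun u v z => φ (t :: u) v z) ts

theorem groupSum_eq_sum (φ : List PTree → List PTree → List PTree → N) (ts : List PTree) :
    groupSum φ ts = ∑ r ∈ Finset.range (ts.length + 1), ∑ n ∈ Finset.range (ts.length + 1),
      if 2 ≤ n ∧ r + n ≤ ts.length then φ (ts.take r) ((ts.drop r).take n) (ts.drop (r + n))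
      else 0 := by
  induction ts generalizing φ with
  | nil => simp [groupSum]
  | cons t ts ih =>
    rw [groupSum, ih, cutSum_eq_sum, List.length_cons, add_comm]
    refine Eq.trans ?_ (Finset.sum_range_succ' _ (ts.length + 1)).symm
    refine (congrArg₂ (· + ·) ?_ ?_)
    · refine Finset.sum_congr rfl fun r _ => ?_
      rw [Finset.sum_range_succ _ (ts.length + 1), if_neg (by omega), add_zero]
      refine Finset.sum_congr rfl fun n _ => ?_
      simp only [show r + 1 + n = r + n + 1 by omega, List.take_succ_cons, List.drop_succ_cons,
        Nat.add_le_add_iff_right]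
    · refine Finset.sum_congr rfl fun n hn => ?_
      rw [Finset.mem_range] at hn
      have : ((t :: ts).take n).length = n := by simp; omega
      simp only [this, zero_add, List.take_zero, List.drop_zero]
      by_cases h : 2 ≤ n
      · rw [if_pos h, if_pos ⟨h, by omega⟩]
      · rw [if_neg h, if_neg (by omega)]

theorem groupSum_map (L : N →+ N') (φ : List PTree → List PTree → List PTree → N)
    (ts : List PTree) : groupSum (fun u v z => L (φ u v z)) ts = L (groupSum φ ts) := by
  induction ts generalizing φ with
  | nil => simp [groupSum]
  | cons t ts ih =>
    simp only [groupSum, ih, map_add, ← cutSum_map]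
    congr 2
    funext v z
    split_ifs <;> simp

/-- The extra summand is the grouping of all branches, which `groupings` leaves out: contracting the
new edge would not restore a reduced tree with an edge at the old vertex having at least two inputs.
-/
theorem sum_groupings (φ : List PTree → List PTree → List PTree → N) (ts : List PTree) :
    groupSum φ ts = ((groupings ts).map fun g => φ g.1 g.2.1 g.2.2).sum +
      if 2 ≤ ts.length then φ [] ts [] else 0 := by
  rw [groupSum_eq_sum, groupings, sum_map_flatMap_range]
  simp only [sum_map_filter_range]
  simp only [Finset.sum_range_succ _ ts.length]
  rw [← Finset.sum_range_succ (fun r => ((∑ n ∈ Finset.range ts.length,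
    if 2 ≤ n ∧ r + n ≤ ts.length then φ (ts.take r) ((ts.drop r).take n) (ts.drop (r + n))
      else 0) + if 2 ≤ ts.length ∧ r + ts.length ≤ ts.length then
        φ (ts.take r) ((ts.drop r).take ts.length) (ts.drop (r + ts.length)) else 0)),
    ← Finset.sum_range_succ (fun r => ∑ n ∈ Finset.range ts.length,
    if 2 ≤ n ∧ r + n ≤ ts.length then φ (ts.take r) ((ts.drop r).take n) (ts.drop (r + n))
      else 0), Finset.sum_add_distrib]
  congr 1
  rw [Finset.sum_range_succ', Finset.sum_eq_zero fun r _ => if_neg (by omega)]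
  simp

theorem cutSum_only (F : List PTree → PTree → N) (t : PTree) (ts : List PTree) :
    cutSum (fun v z => only (F z) v) (t :: ts) = F ts t := by
  match ts with
  | [] => simp [cutSum, only]
  | s :: ts => simp [cutSum, only, cutSum_zero]

/-- Unrolls the recursion of `coder` into the two kinds of moves that occur in `expand`: gathering a
run of trees under a new vertex, and expanding a single tree. -/
theorem coder_eq (f : List PTree → N) (ts : List PTree) :
    coder f ts = groupSum (fun u v z => forestSign u • f (u ++ node v :: z)) ts -
      forestExpandSum f ts := by
  induction ts generalizing f with
  | nil => simp [coder, groupSum, forestExpandSum_nil]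
  | cons t ts ih =>
    rw [coder, ih, forestExpandSum_cons, groupSum, ← cutSum_only (fun z => expandSum
      fun s => f (s :: z))]
    have h1 := groupSum_map (DistribSMul.toAddMonoidHom N t.sign)
      (fun u v z => forestSign u • f (t :: (u ++ node v :: z))) ts
    simp only [DistribSMul.toAddMonoidHom_apply, smul_smul] at h1
    simp only [forestSign_cons, List.cons_append, h1, smul_sub]
    have h2 := cutSum_add (fun v z => corolla (fun s => f (s :: z)) v)
      (fun v z => only (expandSum fun s => f (s :: z)) v) (t :: ts)
    simp only [corolla_eq, sub_add_cancel] at h2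
    simp only [corolla_eq, forestSign_nil, one_smul, List.nil_append]
    simp only [branch] at h2 ⊢
    rw [h2]
    abel

/-- The link between trees and coderivations. Gathering branches has height |u| + 2, hence the sign
of `u`; expanding a branch shifts heights by 1 because of the root, hence the minus sign of
`forestExpandSum` in `coder`. -/
theorem expandSum_node (φ : PTree → N) (ts : List PTree) (h : 2 ≤ ts.length) :
    expandSum φ (node ts) = coder (branch φ) ts := by
  rw [coder_eq, sum_groupings, if_pos h]
  -- Gathering all branches leaves a forest with a single tree, which `branch` sends to zero; this
  -- matches its omission from `groupings`.
  rw [show branch φ ([] ++ node ts :: []) = 0 from if_neg (by simp), smul_zero, add_zero,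
    expandSum, expand, List.map_append, List.sum_append, sub_eq_add_neg]
  congr 1
  · rw [List.map_map]
    congr 1
    refine List.map_congr_left fun g hg => ?_
    obtain ⟨h1, h2, h3⟩ := mem_groupings hg
    have hl := congrArg List.length h1
    simp only [List.length_append] at hl
    rw [branch, if_pos (by simp; omega)]
    simp [Int.negOnePow_add, forestSign]
  · rw [forestExpandSum, List.map_map, ← neg_one_smul ℤ, List.smul_sum, List.map_map]
    congr 1
    refine List.map_congr_left fun e he => ?_
    rw [Function.comp, Function.comp, branch, if_pos (by rw [(expandForest_spec _ _ he).2.2.2]; exact h)]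
    simp [Int.negOnePow_add, Units.neg_smul]

/-- Split the outer `corolla` into grafting and expansion. Grafting after `coder` gives the
expansions of `node ts` by `expandSum_node`; grafting everything first and then expanding gives the
same sum with the opposite sign. -/
theorem coder_corolla (φ : PTree → N) (ts : List PTree) (h : 2 ≤ ts.length) :
    coder (corolla φ) ts = 0 := by
  rw [show corolla φ = fun us => branch φ us + (-1 : ℤˣ) • only (expandSum φ) us from by
    funext us; rw [corolla_eq]; simp [sub_eq_add_neg], coder_add, coder_smul, coder_only,
    ← expandSum_node φ ts h]
  match ts, h with
  | t :: s :: ts, _ => simp [corolla]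

theorem coder_corolla_singleton (φ : PTree → N) (t : PTree) :
    coder (corolla φ) [t] = expandSum (expandSum φ) t := by
  rw [show corolla φ = fun us => branch φ us + (-1 : ℤˣ) • only (expandSum φ) us from by
    funext us; rw [corolla_eq]; simp [sub_eq_add_neg], coder_add, coder_smul, coder_only,
    coder_branch_of_length_lt _ _ (by simp)]
  simp [corolla]

-- Mutual recursion over a tree and its branches. The double expansion of `node ts` is the square of
-- `coder` applied to `branch φ`, so `coder_coder` reduces it to components: runs of at least two
-- branches are covered by `coder_corolla`, single branches by the recursive call.
mutual
theorem expandSum_expandSum : ∀ (t : PTree) (φ : PTree → N), t.Reduced →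
    expandSum (expandSum φ) t = 0
  | leaf, φ, _ => by simp [expandSum, expand]
  | node ts, φ, h => by
    simp only [Reduced] at h
    rw [expandSum_node _ _ h.1]
    rw [show branch (expandSum φ) = coder (branch φ) from by
      funext us
      by_cases hus : 2 ≤ us.length
      · rw [branch, if_pos hus, expandSum_node φ us hus]
      · rw [branch, if_neg hus, coder_branch_of_length_lt φ us (by omega)]]
    refine coder_coder _ _ fun v u z ψ e => ?_
    match v with
    | [] => rfl
    | [t] =>
      rw [coder_corolla_singleton]
      exact forest_expandSum_expandSum ts ψ h.2 t (by simp [← e])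
    | t :: s :: v => exact coder_corolla ψ _ (by simp)
theorem forest_expandSum_expandSum : ∀ (ts : List PTree) (φ : PTree → N), ForestReduced ts →
    ∀ t ∈ ts, expandSum (expandSum φ) t = 0
  | [], _, _, t, ht => by simp at ht
  | s :: ts, φ, h, t, ht => by
    simp only [ForestReduced] at h
    rcases List.mem_cons.1 ht with e | ht
    · exact e ▸ expandSum_expandSum s φ h.1
    · exact forest_expandSum_expandSum ts φ h.2 t ht
end

end Combinatorics

end PTree

/-! ### Additive functions of words -/

namespace GradedQuiver

variable {k : Type u} [CommRing k] {A : GradedQuiver k}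

namespace Word

/-- All letters of a word satisfy `P`. -/
def All (P : ∀ (X Y : A.Obj) (p : ℤ), A.Hom X Y p → Prop) : {X Y : A.Obj} → A.Word X Y → Prop
  | X, Y, .single x => P X Y _ x
  | X, _, @Word.cons _ _ _ _ Z _ _ x w => P X Z _ x ∧ w.All P

/-- The third word is obtained by adding up the first two in one letter, the other letters being
the same. -/
inductive AddRel : {X Y : A.Obj} → A.Word X Y → A.Word X Y → A.Word X Y → Prop
  | single {X Y : A.Obj} {p : ℤ} (x y : A.Hom X Y p) :
      AddRel (.single x) (.single y) (.single (x + y))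
  | head {X Z Y : A.Obj} {p : ℤ} (x y : A.Hom X Z p) (w : A.Word Z Y) :
      AddRel (.cons x w) (.cons y w) (.cons (x + y) w)
  | tail {X Z Y : A.Obj} {p : ℤ} (x : A.Hom X Z p) {w w' w'' : A.Word Z Y} (h : AddRel w w' w'') :
      AddRel (.cons x w) (.cons x w') (.cons x w'')

variable {N : Type u} [AddCommGroup N] {X Y Z : A.Obj}

/-- A function of words is additive in each letter. -/
def IsMultiadditive (F : A.Word X Y → N) : Prop :=
  ∀ w w' w'' : A.Word X Y, AddRel w w' w'' → F w'' = F w + F w'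

/-- A function of words is given by additive maps of the tensor products. -/
def IsAdditive (F : A.Word X Y → N) : Prop :=
  ∃ L : ∀ W : DegPath A.Obj X Y, A.tensor W →+ N, ∀ w, F w = L w.shape w.tprod

theorem IsAdditive.cons {F : A.Word X Y → N} (hF : IsAdditive F) {p : ℤ} (x : A.Hom X Z p) :
    IsAdditive fun w => F (.cons x w) := by
  obtain ⟨L, hL⟩ := hF
  exact ⟨fun W => (L (.cons p W)).comp (TensorProduct.mk k _ (A.tensor W) x).toAddMonoidHom,
    fun w => hL _⟩

theorem IsAdditive.cons_left {F : A.Word X Y → N} (hF : IsAdditive F) {p : ℤ}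
    (z : A.Word Z Y) : ∃ L : A.Hom X Z p →+ N, ∀ x, F (.cons x z) = L x := by
  obtain ⟨L, hL⟩ := hF
  exact ⟨(L (.cons p z.shape)).comp
    ((TensorProduct.mk k (A.Hom X Z p) (A.tensor z.shape)).flip z.tprod).toAddMonoidHom,
    fun x => hL _⟩

theorem IsAdditive.single {F : A.Word X Y → N} (hF : IsAdditive F) {p : ℤ} :
    ∃ L : A.Hom X Y p →+ N, ∀ x, F (.single x) = L x := by
  obtain ⟨L, hL⟩ := hF
  exact ⟨L (.single p), fun x => hL _⟩

theorem IsAdditive.isMultiadditive {F : A.Word X Y → N} (hF : IsAdditive F) :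
    IsMultiadditive F := by
  intro w w' w'' h
  induction h with
  | @single X Y p x y => obtain ⟨L, hL⟩ := hF.single (p := p); simp [hL]
  | @head X Z Y p x y w => obtain ⟨L, hL⟩ := hF.cons_left (p := p) w; simp [hL]
  | tail x h ih => exact ih (hF.cons x)

theorem IsMultiadditive.add {F G : A.Word X Y → N} (hF : IsMultiadditive F)
    (hG : IsMultiadditive G) : IsMultiadditive fun w => F w + G w := by
  intro w w' w'' h
  simp only [hF _ _ _ h, hG _ _ _ h]
  abel

theorem IsMultiadditive.sub {F G : A.Word X Y → N} (hF : IsMultiadditive F)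
    (hG : IsMultiadditive G) : IsMultiadditive fun w => F w - G w := by
  intro w w' w'' h
  simp only [hF _ _ _ h, hG _ _ _ h]
  abel

/-- Lets identities of words be checked on generators only: each letter is replaced in turn by a sum
of generators and their negatives. Additivity suffices, linearity over `k` is not needed. -/
theorem eq_zero_of_all {S : ∀ (X Y : A.Obj) (p : ℤ), Set (A.Hom X Y p)}
    (hS : ∀ X Y p, AddSubgroup.closure (S X Y p) = ⊤) {F : A.Word X Y → N}
    (hF : IsMultiadditive F) (h : ∀ w : A.Word X Y, w.All (fun X Y p x => x ∈ S X Y p) → F w = 0)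
    (w : A.Word X Y) : F w = 0 := by
  have key : ∀ {X Z : A.Obj} {p : ℤ} (G : A.Hom X Z p → N),
      (∀ x y, G (x + y) = G x + G y) → (∀ x ∈ S X Z p, G x = 0) → ∀ x, G x = 0 := by
    intro X Z p G hG h0 x
    have hx : x ∈ AddSubgroup.closure (S X Z p) := by rw [hS]; trivial
    induction hx using AddSubgroup.closure_induction with
    | mem x hx => exact h0 x hx
    | zero => simpa using hG 0 0
    | add x y _ _ hx hy => rw [hG, hx, hy, add_zero]
    | neg x _ hx =>
      have h1 := hG x (-x)
      rw [add_neg_cancel, hx, zero_add] at h1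
      rw [← h1]
      simpa using hG 0 0
  induction w with
  | @single X Y p x =>
    exact key (p := p) (fun x => F (.single x)) (fun x y => hF _ _ _ (.single x y))
      (fun x hx => h _ hx) x
  | @cons X Z Y p x w ih =>
    refine key (p := p) (fun x => F (.cons x w)) (fun x y => hF _ _ _ (.head x y w)) (fun x hx => ?_) x
    exact ih (F := fun w => F (.cons x w)) (fun _ _ _ hw => hF _ _ _ (.tail x hw))
      fun w hw => h _ ⟨hx, hw⟩

theorem splitSum_add (G G' : ∀ Z : A.Obj, A.Word X Z → A.Word Z Y → N) (w : A.Word X Y) :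
    splitSum (fun Z v z => G Z v z + G' Z v z) w = splitSum G w + splitSum G' w := by
  induction w with
  | single x => simp [splitSum]
  | cons x w ih => simp only [splitSum, ih]; abel

theorem isMultiadditive_splitSum {G : ∀ Z : A.Obj, A.Word X Z → A.Word Z Y → N}
    (h₁ : ∀ Z z, IsMultiadditive fun v => G Z v z)
    (h₂ : ∀ Z v, IsMultiadditive fun z => G Z v z) : IsMultiadditive (splitSum G) := by
  intro w w' w'' h
  induction h with
  | single x y => simp [splitSum]
  | head x y w =>
    simp only [splitSum]
    rw [show G _ (single (x + y)) w = _ from h₁ _ w _ _ _ (.single x y), show (fun Z' v z => G Z' (Word.cons (x + y) v) z) =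
      fun Z' v z => G Z' (Word.cons x v) z + G Z' (Word.cons y v) z from by
        funext Z' v z; exact h₁ _ z _ _ _ (.head x y v), splitSum_add]
    abel
  | tail x h ih =>
    simp only [splitSum]
    rw [show G _ (single x) _ = _ from h₂ _ (single x) _ _ _ h, ih (fun Z z _ _ _ hv => h₁ Z z _ _ _ (.tail x hv))
      (fun Z v => h₂ Z _)]
    abel

theorem AddRel.map {B : GradedQuiver k} (f : A.Obj → B.Obj)
    (f₁ : ∀ (X Y : A.Obj) (p : ℤ), A.Hom X Y p →ₗ[k] B.Hom (f X) (f Y) p)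
    {w w' w'' : A.Word X Y} (h : AddRel w w' w'') :
    AddRel (w.map f f₁) (w'.map f f₁) (w''.map f f₁) := by
  induction h with
  | single x y => simp only [Word.map, map_add]; exact .single _ _
  | head x y w => simp only [Word.map, map_add]; exact .head _ _ _
  | tail x h ih => exact .tail _ ih

end Word

end GradedQuiver

-- Additivity of the sums in the A∞-equations

namespace AInfData

open GradedQuiver

variable {k : Type u} [CommRing k] (A : AInfData k) {N : Type u} [AddCommGroup N] {X Y : A.Obj}

/-- `(x₁ ⊗ ⋯ ⊗ xₙ) bₙ`, in the direct sum of the graded components. -/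
def bTotal (w : A.Word X Y) : ⨁ q, A.Hom X Y q :=
  DirectSum.of (fun q => A.Hom X Y q) (w.sdeg + 2) (A.bVal w)

theorem of_bWord (w : A.Word X Y) (q : ℤ) (h : w.sdeg + 1 = q - 1) :
    DirectSum.of (fun q => A.Hom X Y q) q (A.bWord w q h) = A.bTotal w := by
  obtain rfl : q = w.sdeg + 2 := by omega
  rfl

theorem isAdditive_bTotal : Word.IsAdditive (A.bTotal (X := X) (Y := Y)) :=
  ⟨fun W => (DirectSum.of (fun q => A.Hom X Y q) (W.sdeg + 2)).comp
    (A.b W (W.sdeg + 2) (by ring)).toAddMonoidHom, fun _ => rfl⟩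

theorem headSum_add (F G : A.Word X Y → N) (w : A.Word X Y) :
    A.headSum (fun w => F w + G w) w = A.headSum F w + A.headSum G w := by
  simp only [headSum, smul_add, Word.splitSum_add]
  abel

theorem bSum_add (F G : A.Word X Y → N) (w : A.Word X Y) :
    A.bSum (fun w => F w + G w) w = A.bSum F w + A.bSum G w := by
  induction w with
  | single x => exact A.headSum_add F G _
  | cons x w ih =>
    simp only [bSum, headSum_add, ih]
    abel

theorem isMultiadditive_headSum {F : A.Word X Y → N} (hF : Word.IsAdditive F) :
    Word.IsMultiadditive (A.headSum F) := by
  obtain ⟨L, hL⟩ := id hF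
  refine Word.IsMultiadditive.add (Word.IsAdditive.isMultiadditive ?_)
    (Word.isMultiadditive_splitSum (fun Z z => Word.IsAdditive.isMultiadditive ?_)
      fun Z v => Word.IsAdditive.isMultiadditive ?_)
  · exact ⟨fun W => (L (.single (W.sdeg + 2))).comp
      (A.b W (W.sdeg + 2) (by ring)).toAddMonoidHom, fun w => hL _⟩
  · have h := fun p => hF.cons_left (p := p) z
    choose L' hL' using h
    exact ⟨fun V => (DistribSMul.toAddMonoidHom N z.sdeg.negOnePow).comp
      ((L' (V.sdeg + 2)).comp (A.b V (V.sdeg + 2) (by ring)).toAddMonoidHom),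
      fun v => congrArg (z.sdeg.negOnePow • ·) (hL' _ _)⟩
  · obtain ⟨L', hL'⟩ := hF.cons (A.bVal v)
    exact ⟨fun W => (DistribSMul.toAddMonoidHom N W.sdeg.negOnePow).comp (L' W),
      fun z => congrArg (z.sdeg.negOnePow • ·) (hL' z)⟩

/-- A letter enters the sum either as an argument of an operation or as a letter left in place; the
first case is additive through `headSum`, the second through `F` itself. -/
theorem isMultiadditive_bSum {F : A.Word X Y → N} (hF : Word.IsAdditive F) :
    Word.IsMultiadditive (A.bSum F) := by
  intro w w' w'' h
  induction h with
  | single x y => exact A.isMultiadditive_headSum hF _ _ _ (.single x y)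
  | head x y w =>
    simp only [bSum]
    rw [A.isMultiadditive_headSum hF _ _ _ (.head x y w)]
    rw [funext fun w' => hF.isMultiadditive _ _ _ (.head x y w'), bSum_add]
    abel
  | tail x h ih =>
    simp only [bSum]
    rw [A.isMultiadditive_headSum hF _ _ _ (.tail x h), ih (hF.cons x)]
    abel

end AInfData

open scoped Classical

/-! ### The differential of the tensor algebra -/

namespace DegPath

variable {O : Type u}

@[simp] theorem sdeg_append {X Z Y : O} (w : DegPath O X Z) (w' : DegPath O Z Y) :
    (w.append w').sdeg = w.sdeg + w'.sdeg := by
  induction w with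
  | single p => rfl
  | cons p w ih => simp [append, sdeg, ih, add_assoc]

@[simp] theorem length_append {X Z Y : O} (w : DegPath O X Z) (w' : DegPath O Z Y) :
    (w.append w').length = w.length + w'.length := by
  induction w with
  | single p => simp [append, length, add_comm]
  | cons p w ih => simp [append, length, ih]; ring

end DegPath

namespace GradedQuiver

variable {k : Type u} [CommRing k] (A : GradedQuiver k) {X Y Z V : A.Obj}

/-- The inclusion of a summand of `T^{≥ 1}A(X, Y)`. -/
def totalι (w : DegPath A.Obj X Y) : A.tensor w →ₗ[k] A.Total X Y :=
  DirectSum.lof k _ (fun w' : DegPath A.Obj X Y => A.tensor w') w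

variable {A}

theorem total_hom_ext {N : Type*} [AddCommGroup N] {f g : A.Total X Y →+ N}
    (h : ∀ w ξ, f (A.totalι w ξ) = g (A.totalι w ξ)) : f = g :=
  DirectSum.addHom_ext h

theorem total_linearMap_ext {N : Type*} [AddCommGroup N] [Module k N]
    {f g : A.Total X Y →ₗ[k] N} (h : ∀ w ξ, f (A.totalι w ξ) = g (A.totalι w ξ)) : f = g :=
  LinearMap.toAddMonoidHom_injective (total_hom_ext h)

variable (A) in
/-- The product of `T^{≥ 1}A`, given by concatenation. -/
def mulTotal : A.Total X Z →ₗ[k] A.Total Z Y →ₗ[k] A.Total X Y :=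
  DirectSum.toModule k _ _ fun w => LinearMap.flip (DirectSum.toModule k _ _ fun w' =>
    LinearMap.flip ((TensorProduct.mk k (A.tensor w) (A.tensor w')).compr₂
      ((A.totalι (w.append w')).comp (A.mulTensor w w'))))

theorem mulTotal_totalι (w : DegPath A.Obj X Z) (w' : DegPath A.Obj Z Y) (ξ : A.tensor w)
    (η : A.tensor w') : A.mulTotal (A.totalι w ξ) (A.totalι w' η) =
      A.totalι (w.append w') (A.mulTensor w w' (ξ ⊗ₜ η)) := by
  simp only [mulTotal, totalι]
  erw [DirectSum.toModule_lof]
  rw [LinearMap.flip_apply]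
  erw [DirectSum.toModule_lof]
  rfl

variable (A) in
/-- The inclusion of the words of length `1`. -/
def letterι (p : ℤ) : A.Hom X Y p →ₗ[k] A.Total X Y :=
  A.totalι (DegPath.single p : DegPath A.Obj X Y)

theorem totalι_cons (p : ℤ) (w : DegPath A.Obj Z Y) (x : A.Hom X Z p) (ξ : A.tensor w) :
    A.totalι (DegPath.cons p w : DegPath A.Obj X Y) (x ⊗ₜ[k] ξ : A.Hom X Z p ⊗[k] A.tensor w) =
      A.mulTotal (A.letterι p x) (A.totalι w ξ) :=
  (mulTotal_totalι (DegPath.single p : DegPath A.Obj X Z) w x ξ).symm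

theorem consTotal_tmul (p : ℤ) (x : A.Hom X Z p) (b : A.Total Z Y) :
    A.consTotal p (x ⊗ₜ b) = A.mulTotal (A.letterι p x) b := by
  have : (A.consTotal p).comp (TensorProduct.mk k _ (A.Total Z Y) x) =
      A.mulTotal (A.letterι p x) := by
    refine total_linearMap_ext fun w ξ => ?_
    rw [← totalι_cons]
    simp only [consTotal, totalι, LinearMap.comp_apply, TensorProduct.mk_apply,
      TensorProduct.lift.tmul, LinearMap.flip_apply]
    erw [DirectSum.toModule_lof]
    rfl
  exact LinearMap.congr_fun this b

theorem total_induction {P : A.Total X Y → Prop} (h₁ : ∀ w ξ, P (A.totalι w ξ))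
    (h₂ : ∀ a b, P a → P b → P (a + b)) (a : A.Total X Y) : P a := by
  induction a using DirectSum.induction_on with
  | zero => simpa using h₁ (.single 0) 0
  | of w ξ => exact h₁ w ξ
  | add a b ha hb => exact h₂ a b ha hb

theorem mulTotal_letterι_assoc (p : ℤ) (x : A.Hom X Z p) (b : A.Total Z V) (c : A.Total V Y) :
    A.mulTotal (A.mulTotal (A.letterι p x) b) c = A.mulTotal (A.letterι p x) (A.mulTotal b c) := by
  induction b using total_induction with
  | h₂ a b ha hb => simp only [map_add, LinearMap.add_apply, ha, hb]
  | h₁ w ξ =>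
    induction c using total_induction with
    | h₂ a b ha hb => simp only [map_add, ha, hb]
    | h₁ w' η =>
      rw [mulTotal_totalι, ← totalι_cons, ← totalι_cons]
      exact mulTotal_totalι (DegPath.cons p w) w' _ η

variable (A) in
/-- The inclusion of the words with first letter of degree `p` and with the other letters indexed
by `w`. -/
def consι (p : ℤ) (w : DegPath A.Obj Z Y) : A.Hom X Z p ⊗[k] A.tensor w →ₗ[k] A.Total X Y :=
  A.totalι (DegPath.cons p w : DegPath A.Obj X Y)

theorem consι_tmul (p : ℤ) (w : DegPath A.Obj Z Y) (x : A.Hom X Z p) (ξ : A.tensor w) :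
    A.consι p w (x ⊗ₜ[k] ξ) = A.mulTotal (A.letterι p x) (A.totalι w ξ) :=
  totalι_cons p w x ξ

/-- Induction on the number of letters that keeps track of the path, so that `P` may involve its
length and degree; pure tensors are reached by prefixing a letter, the others by sums. -/
theorem totalι_induction {P : ∀ {X Y : A.Obj}, DegPath A.Obj X Y → A.Total X Y → Prop}
    (letter : ∀ {X Y : A.Obj} (p : ℤ) (x : A.Hom X Y p), P (.single p) (A.letterι p x))
    (cons : ∀ {X Z Y : A.Obj} (p : ℤ) (x : A.Hom X Z p) (w : DegPath A.Obj Z Y) (ξ : A.tensor w),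
      P w (A.totalι w ξ) → P (.cons p w) (A.mulTotal (A.letterι p x) (A.totalι w ξ)))
    (add : ∀ {X Y : A.Obj} (w : DegPath A.Obj X Y) (a b : A.Total X Y),
      P w a → P w b → P w (a + b))
    (w : DegPath A.Obj X Y) (ξ : A.tensor w) : P w (A.totalι w ξ) := by
  induction w with
  | single p => exact letter p ξ
  | @cons X Z Y p w ih =>
    have key : ∀ ξ : A.Hom X Z p ⊗[k] A.tensor w, P (.cons p w) (A.consι p w ξ) := by
      intro ξ
      induction ξ using TensorProduct.induction_on with
      | zero =>
        have := cons p (0 : A.Hom X Z p) w 0 (ih 0)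
        rwa [← consι_tmul, TensorProduct.zero_tmul] at this
      | tmul x ξ => rw [consι_tmul]; exact cons p x w ξ (ih ξ)
      | add a b ha hb => rw [map_add]; exact add _ _ _ ha hb
    exact key ξ

theorem mulTotal_assoc {U : A.Obj} (a : A.Total X Z) (b : A.Total Z V) (c : A.Total V U) :
    A.mulTotal (A.mulTotal a b) c = A.mulTotal a (A.mulTotal b c) := by
  induction a using total_induction with
  | h₂ a b ha hb => simp only [map_add, LinearMap.add_apply, ha, hb]
  | h₁ w ξ =>
    refine totalι_induction (P := fun {X Z} _ a => ∀ (b : A.Total Z V) (c : A.Total V U),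
      A.mulTotal (A.mulTotal a b) c = A.mulTotal a (A.mulTotal b c)) ?_ ?_ ?_ w ξ b c
    · exact fun p x b c => mulTotal_letterι_assoc p x b c
    · intro X Y Z p x w ξ ih b c
      rw [mulTotal_letterι_assoc, mulTotal_letterι_assoc, mulTotal_letterι_assoc, ih]
    · intro X Y w a a' ha ha' b c
      simp only [map_add, LinearMap.add_apply, ha, ha']

variable (A) in
/-- The subgroup spanned by the summands with `n` tensor factors and total degree `m`. -/
def totalDeg (X Y : A.Obj) (n : ℕ) (m : ℤ) : AddSubgroup (A.Total X Y) :=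
  AddSubgroup.closure {a | ∃ (w : DegPath A.Obj X Y) (ξ : A.tensor w),
    w.length = n ∧ w.sdeg = m ∧ A.totalι w ξ = a}

theorem totalι_mem_totalDeg (w : DegPath A.Obj X Y) (ξ : A.tensor w) :
    A.totalι w ξ ∈ A.totalDeg X Y w.length w.sdeg :=
  AddSubgroup.subset_closure ⟨w, ξ, rfl, rfl, rfl⟩

theorem letterι_mem (p : ℤ) (x : A.Hom X Y p) :
    A.letterι p x ∈ A.totalDeg X Y 1 (p - 1) :=
  totalι_mem_totalDeg (A := A) (DegPath.single p : DegPath A.Obj X Y) x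

theorem mulTotal_mem_totalDeg {a : A.Total X Z} {b : A.Total Z Y} {n n' : ℕ} {m m' : ℤ}
    (ha : a ∈ A.totalDeg X Z n m) (hb : b ∈ A.totalDeg Z Y n' m') :
    A.mulTotal a b ∈ A.totalDeg X Y (n + n') (m + m') := by
  induction ha using AddSubgroup.closure_induction with
  | zero => rw [map_zero, LinearMap.zero_apply]; exact zero_mem _
  | add x y _ _ hx hy => rw [map_add, LinearMap.add_apply]; exact add_mem hx hy
  | neg x _ hx => rw [map_neg, LinearMap.neg_apply]; exact neg_mem hx
  | mem x hx =>
    obtain ⟨w, ξ, rfl, rfl, rfl⟩ := hx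
    induction hb using AddSubgroup.closure_induction with
    | zero => rw [map_zero]; exact zero_mem _
    | add x y _ _ hx hy => rw [map_add]; exact add_mem hx hy
    | neg x _ hx => rw [map_neg]; exact neg_mem hx
    | mem x hx =>
      obtain ⟨w', ξ', rfl, rfl, rfl⟩ := hx
      rw [mulTotal_totalι, ← DegPath.length_append, ← DegPath.sdeg_append]
      exact totalι_mem_totalDeg _ _

end GradedQuiver

-- Leibniz rule and square of the tensor differential

section

open GradedQuiver

variable {k : Type u} [CommRing k] (Q : DGQuiver k) {X Y Z : Q.Obj}

/-- The differential of `T^{≥ 1}sQ(X, Y)`. -/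
def totalD : Q.toGraded.Total X Y →ₗ[k] Q.toGraded.Total X Y :=
  DirectSum.toModule k _ _ fun w => tensorD Q w

theorem totalD_totalι (w : DegPath Q.Obj X Y) (ξ : Q.toGraded.tensor w) :
    totalD Q (Q.toGraded.totalι w ξ) = tensorD Q w ξ := by
  simp only [totalD, totalι]
  erw [DirectSum.toModule_lof]

theorem totalD_letterι (p : ℤ) (x : Q.toGraded.Hom X Y p) :
    totalD Q (Q.toGraded.letterι p x) =
      Q.toGraded.letterι (p + 1) (((Q.Hom X Y).d p (p + 1)).hom x) :=
  totalD_totalι Q (DegPath.single p : DegPath Q.Obj X Y) x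

theorem totalD_letter_mul (p : ℤ) (x : Q.toGraded.Hom X Z p) (w : DegPath Q.Obj Z Y)
    (ξ : Q.toGraded.tensor w) :
    totalD Q (Q.toGraded.mulTotal (Q.toGraded.letterι p x) (Q.toGraded.totalι w ξ)) =
      w.sdeg.negOnePow • Q.toGraded.mulTotal (totalD Q (Q.toGraded.letterι p x))
        (Q.toGraded.totalι w ξ) +
      Q.toGraded.mulTotal (Q.toGraded.letterι p x) (totalD Q (Q.toGraded.totalι w ξ)) := by
  rw [totalD_letterι, ← consι_tmul p w x ξ, ← consι_tmul (A := Q.toGraded) (p + 1) w _ ξ, totalD_totalι Q w,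
    ← consTotal_tmul]
  exact totalD_totalι Q (DegPath.cons p w : DegPath Q.Obj X Y) _

/-- The sign involves `b` and not `a` because operators act on the right: the differential passes
`b` to reach `a`. The recursive definition gives the case of a single letter, and associativity the
rest. -/
theorem totalD_mul {m : ℤ} {n : ℕ} (a : Q.toGraded.Total X Z) {b : Q.toGraded.Total Z Y}
    (hb : b ∈ Q.toGraded.totalDeg Z Y n m) :
    totalD Q (Q.toGraded.mulTotal a b) =
      m.negOnePow • Q.toGraded.mulTotal (totalD Q a) b + Q.toGraded.mulTotal a (totalD Q b) := by
  induction hb using AddSubgroup.closure_induction with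
  | zero => simp only [map_zero, smul_zero, add_zero]
  | add x y _ _ hx hy => simp only [map_add, hx, hy, smul_add]; abel
  | neg x _ hx => simp only [map_neg, hx, smul_neg]; abel
  | mem x hx =>
    obtain ⟨w', η, rfl, rfl, rfl⟩ := hx
    induction a using total_induction with
    | h₂ a b ha hb => simp only [map_add, LinearMap.add_apply, ha, hb, smul_add]; abel
    | h₁ w ξ =>
      refine totalι_induction (A := Q.toGraded) (P := fun {X Z} w a => ∀ {Y : Q.Obj}
        (w' : DegPath Q.Obj Z Y) (η : Q.toGraded.tensor w'),
        totalD Q (Q.toGraded.mulTotal a (Q.toGraded.totalι w' η)) =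
          w'.sdeg.negOnePow • Q.toGraded.mulTotal (totalD Q a) (Q.toGraded.totalι w' η) +
            Q.toGraded.mulTotal a (totalD Q (Q.toGraded.totalι w' η))) ?_ ?_ ?_ w ξ w' η
      · exact fun p x _ w' η => totalD_letter_mul Q p x w' η
      · intro X Y Z p x w ξ ih _ w' η
        rw [mulTotal_letterι_assoc, mulTotal_totalι, totalD_letter_mul, totalD_letter_mul,
          ← mulTotal_totalι, ih]
        simp only [map_add, LinearMap.add_apply, mulTotal_assoc, DegPath.sdeg_append,
          Int.negOnePow_add, Units.smul_def, map_zsmul, LinearMap.smul_apply, smul_add, smul_smul,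
          Units.val_mul, mul_comm, add_assoc]
      · intro X Y w a a' ha ha' _ w' η
        simp only [map_add, LinearMap.add_apply, ha, ha', smul_add]
        abel

theorem totalD_mem {n : ℕ} {m : ℤ} {b : Q.toGraded.Total X Y}
    (hb : b ∈ Q.toGraded.totalDeg X Y n m) :
    totalD Q b ∈ Q.toGraded.totalDeg X Y n (m + 1) := by
  induction hb using AddSubgroup.closure_induction with
  | zero => rw [map_zero]; exact zero_mem _
  | add x y _ _ hx hy => rw [map_add]; exact add_mem hx hy
  | neg x _ hx => rw [map_neg]; exact neg_mem hx
  | mem x hx =>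
    obtain ⟨w, ξ, rfl, rfl, rfl⟩ := hx
    refine totalι_induction (A := Q.toGraded) (P := fun {X Y} w a =>
      totalD Q a ∈ Q.toGraded.totalDeg X Y w.length (w.sdeg + 1)) ?_ ?_ ?_ w ξ
    · intro X Y p x
      rw [totalD_letterι, DegPath.sdeg, show p - 1 + 1 = p + 1 - 1 by ring]
      exact letterι_mem _ _
    · intro X Z Y p x w ξ ih
      rw [totalD_letter_mul, totalD_letterι, DegPath.length, add_comm w.length]
      refine add_mem ?_ ?_
      · rw [Units.smul_def]
        refine zsmul_mem ?_ _
        have := mulTotal_mem_totalDeg (letterι_mem (p + 1) (((Q.Hom _ _).d p (p + 1)).hom x))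
          (totalι_mem_totalDeg w ξ)
        rwa [show p + 1 - 1 + w.sdeg = p - 1 + w.sdeg + 1 by ring] at this
      · have := mulTotal_mem_totalDeg (letterι_mem p x) ih
        rwa [← add_assoc] at this
    · intro X Y w a a' ha ha'
      rw [map_add]
      exact add_mem ha ha'

theorem totalD_totalD (a : Q.toGraded.Total X Y) : totalD Q (totalD Q a) = 0 := by
  induction a using total_induction with
  | h₂ a b ha hb => simp only [map_add, ha, hb, add_zero]
  | h₁ w ξ =>
    have hs : ∀ {X Y : Q.Obj} (p : ℤ) (x : Q.toGraded.Hom X Y p),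
        totalD Q (totalD Q (Q.toGraded.letterι p x)) = 0 := by
      intro X Y p x
      rw [totalD_letterι, totalD_letterι]
      have := congrArg (fun f => f.hom x) ((Q.Hom X Y).d_comp_d p (p + 1) (p + 1 + 1))
      simp only [ModuleCat.hom_comp, LinearMap.comp_apply] at this
      rw [this]
      exact map_zero _
    refine totalι_induction (A := Q.toGraded) (P := fun _ a => totalD Q (totalD Q a) = 0)
      hs ?_ ?_ w ξ
    · intro X Z Y p x w ξ ih
      rw [totalD_letter_mul, map_add, totalD_mul Q _ (totalD_mem Q (totalι_mem_totalDeg w ξ)), ih]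
      simp only [Units.smul_def, map_zsmul]
      rw [totalD_mul Q _ (totalι_mem_totalDeg w ξ), hs]
      simp [Int.negOnePow_add]
    · intro X Y w a a' ha ha'
      simp only [map_add, ha, ha', add_zero]

end

open scoped Classical
open GradedQuiver

/-! ### Words of homogeneous elements of the free A∞-category -/

section

variable {k : Type u} [CommRing k] (Q : DGQuiver k)

/-- The pair `(t, w)` indexes a summand of `FQ(X, Y)^q`. -/
def IsFreeIndex {O : Type u} {X Y : O} (q : ℤ) (t : PTree) (w : DegPath O X Y) : Prop :=
  t.Reduced ∧ t.leaves = w.length ∧ w.sdeg + (t.internal : ℤ) = q - 1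

/-- `freeι`, with values in the free A∞-category. -/
def freeLetter {X Y : Q.Obj} (q : ℤ) (t : PTree) (w : DegPath Q.Obj X Y) :
    Q.toGraded.tensor w →ₗ[k] (freeAInf Q).Hom X Y q :=
  freeι Q q t w

theorem freeLetter_eq {X Y : Q.Obj} {q : ℤ} {t : PTree} {w : DegPath Q.Obj X Y}
    (h : IsFreeIndex q t w) : freeLetter Q q t w =
      DirectSum.lof k _ (fun i : FreeIndex Q.Obj X Y q => Q.toGraded.tensor i.1.2) ⟨(t, w), h⟩ :=
  dif_pos h

theorem closure_freeLetter (X Y : Q.Obj) (q : ℤ) :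
    AddSubgroup.closure {x : (freeAInf Q).Hom X Y q | ∃ (t : PTree) (w : DegPath Q.Obj X Y)
      (ξ : Q.toGraded.tensor w), IsFreeIndex q t w ∧ x = freeLetter Q q t w ξ} = ⊤ := by
  rw [eq_top_iff]
  rintro x -
  refine DirectSum.induction_on (β := fun i : FreeIndex Q.Obj X Y q => Q.toGraded.tensor i.1.2)
    (motive := fun x => x ∈ AddSubgroup.closure {x : (freeAInf Q).Hom X Y q |
      ∃ (t : PTree) (w : DegPath Q.Obj X Y)
      (ξ : Q.toGraded.tensor w), IsFreeIndex q t w ∧ x = freeLetter Q q t w ξ}) x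
    (zero_mem _) (fun i ξ => ?_) (fun _ _ => add_mem)
  refine AddSubgroup.subset_closure ⟨i.1.1, i.1.2, ξ, i.2, ?_⟩
  rw [freeLetter_eq Q i.2]
  rfl

/-- A word of homogeneous elements of the free A∞-category, each in a summand of one tree. -/
inductive TreeWord : Q.Obj → Q.Obj → Type u
  | single {X Y : Q.Obj} {p : ℤ} (t : PTree) (w : DegPath Q.Obj X Y) (h : IsFreeIndex p t w)
      (ξ : Q.toGraded.tensor w) : TreeWord X Y
  | cons {X Z Y : Q.Obj} {p : ℤ} (t : PTree) (w : DegPath Q.Obj X Z) (h : IsFreeIndex p t w)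
      (ξ : Q.toGraded.tensor w) (v : TreeWord Z Y) : TreeWord X Y

namespace TreeWord

variable {Q} {X Y Z : Q.Obj}

/-- The corresponding word. -/
def word : {X Y : Q.Obj} → TreeWord Q X Y → (freeAInf Q).Word X Y
  | _, _, @single _ _ _ _ _ p t w _ ξ => .single (freeLetter Q p t w ξ)
  | _, _, @cons _ _ _ _ _ _ p t w _ ξ v => .cons (freeLetter Q p t w ξ) v.word

/-- The forest of the trees of the letters. -/
def trees : {X Y : Q.Obj} → TreeWord Q X Y → List PTree
  | _, _, single t _ _ _ => [t]
  | _, _, cons t _ _ _ v => t :: v.trees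

/-- The concatenation of the paths of the letters. -/
def path : {X Y : Q.Obj} → TreeWord Q X Y → DegPath Q.Obj X Y
  | _, _, single _ w _ _ => w
  | _, _, cons _ w _ _ v => w.append v.path

/-- The concatenation of the letters. -/
def elt : {X Y : Q.Obj} → (v : TreeWord Q X Y) → Q.toGraded.tensor v.path
  | _, _, single _ _ _ ξ => ξ
  | _, _, cons _ w _ ξ v => Q.toGraded.mulTensor w v.path (ξ ⊗ₜ v.elt)

/-- The concatenation of the letters, in `T^{≥ 1}Q(X, Y)`. -/
def total (v : TreeWord Q X Y) : Q.toGraded.Total X Y := Q.toGraded.totalι v.path v.elt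

/-- The sign of the operator `s^{|t₁|} ⊗ ⋯ ⊗ s^{|tₙ|}`. -/
def sgn : {X Y : Q.Obj} → TreeWord Q X Y → ℤˣ
  | _, _, single _ _ _ _ => 1
  | _, _, cons t _ _ _ v => ((t.internal : ℤ) * v.word.sdeg).negOnePow * v.sgn

/-- Concatenation. -/
def append : {X Z Y : Q.Obj} → TreeWord Q X Z → TreeWord Q Z Y → TreeWord Q X Y
  | _, _, _, single t w h ξ, z => cons t w h ξ z
  | _, _, _, cons t w h ξ v, z => cons t w h ξ (v.append z)

theorem word_sdeg_cons {p : ℤ} (t : PTree) (w : DegPath Q.Obj X Z) (h : IsFreeIndex p t w)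
    (ξ : Q.toGraded.tensor w) (v : TreeWord Q Z Y) :
    (cons t w h ξ v).word.sdeg = p - 1 + v.word.sdeg := rfl

theorem sdeg_append (v : TreeWord Q X Z) (z : TreeWord Q Z Y) :
    (v.append z).word.sdeg = v.word.sdeg + z.word.sdeg := by
  induction v with
  | single => rfl
  | cons t w h ξ v ih => rw [append, word_sdeg_cons, ih, word_sdeg_cons, add_assoc]

/-- Moving the shifts belonging to `v` past the letters of `z` gives the additional sign. -/
theorem sgn_append (v : TreeWord Q X Z) (z : TreeWord Q Z Y) :
    (v.append z).sgn =
      ((PTree.forestInternal v.trees : ℤ) * z.word.sdeg).negOnePow * v.sgn * z.sgn := by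
  induction v with
  | single => simp [append, sgn, trees, PTree.forestInternal]
  | cons t w h ξ v ih =>
    simp only [append, sgn, trees, PTree.forestInternal, ih, sdeg_append, Nat.cast_add, mul_add,
      add_mul, Int.negOnePow_add, ← mul_assoc]
    congr 2
    simp only [mul_comm, mul_assoc]

theorem total_cons {p : ℤ} (t : PTree) (w : DegPath Q.Obj X Z) (h : IsFreeIndex p t w)
    (ξ : Q.toGraded.tensor w) (v : TreeWord Q Z Y) :
    (cons t w h ξ v).total = Q.toGraded.mulTotal (Q.toGraded.totalι w ξ) v.total :=
  (mulTotal_totalι (A := Q.toGraded) w v.path ξ v.elt).symm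

theorem total_append (v : TreeWord Q X Z) (z : TreeWord Q Z Y) :
    (v.append z).total = Q.toGraded.mulTotal v.total z.total := by
  induction v with
  | single t w h ξ => exact total_cons t w h ξ z
  | cons t w h ξ v ih => rw [append, total_cons, ih, total_cons, mulTotal_assoc]

theorem trees_reduced (v : TreeWord Q X Y) : PTree.ForestReduced v.trees := by
  induction v with
  | single t w h ξ => exact ⟨h.1, trivial⟩
  | cons t w h ξ v ih => exact ⟨h.1, ih⟩

theorem leaves_trees (v : TreeWord Q X Y) : PTree.forestLeaves v.trees = v.path.length := by
  induction v with
  | single t w h ξ => simp [trees, PTree.forestLeaves, path, h.2.1]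
  | cons t w h ξ v ih => simp [trees, PTree.forestLeaves, path, h.2.1, ih]

/-- The shift [-|t|] of each summand raises its degree by |t|. -/
theorem sdeg_path (v : TreeWord Q X Y) :
    v.path.sdeg + PTree.forestInternal v.trees = v.word.sdeg := by
  induction v with
  | @single _ _ p t w h ξ =>
    have : (single t w h ξ).word.sdeg = p - 1 := rfl
    rw [this, ← h.2.2]
    simp [trees, PTree.forestInternal, path]
  | cons t w h ξ v ih =>
    rw [word_sdeg_cons, ← ih, ← h.2.2]
    simp only [trees, PTree.forestInternal, path, DegPath.sdeg_append, Nat.cast_add]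
    ring

theorem isFreeIndex_node {q : ℤ} (v : TreeWord Q X Y) (hv : 2 ≤ v.trees.length)
    (h : v.word.sdeg + 1 = q - 1) : IsFreeIndex q (.node v.trees) v.path := by
  refine ⟨⟨hv, v.trees_reduced⟩, v.leaves_trees, ?_⟩
  rw [PTree.internal_node, ← h, ← v.sdeg_path]
  push_cast
  ring

theorem freeConcat_word (v : TreeWord Q X Y) :
    freeConcat Q v.word.shape v.word.tprod = v.sgn • DirectSum.lof k _
      (fun i : List PTree × DegPath Q.Obj X Y => Q.toGraded.tensor i.2)
        (v.trees, v.path) v.elt := by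
  induction v with
  | single t w h ξ =>
    simp only [word, sgn, one_smul, trees, path, elt, Word.shape, Word.tprod]
    rw [freeLetter_eq Q h]
    simp only [freeConcat]
    erw [DirectSum.toModule_lof]
    rfl
  | cons t w h ξ v ih =>
    simp only [word, sgn, trees, path, elt, Word.shape, Word.tprod]
    rw [freeLetter_eq Q h]
    simp only [freeConcat]
    erw [TensorProduct.lift.tmul]
    erw [LinearMap.compl₂_apply, ih]
    erw [DirectSum.toModule_lof]
    rw [LinearMap.flip_apply, Units.smul_def, map_zsmul]
    erw [DirectSum.toModule_lof]
    simp only [LinearMap.smul_apply]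
    refine (smul_smul v.sgn ((t.internal : ℤ) * v.word.sdeg).negOnePow _).trans ?_
    rw [mul_comm v.sgn]
    rfl

theorem bWord_word {q : ℤ} (v : TreeWord Q X Y) (hv : 2 ≤ v.trees.length)
    (h : v.word.sdeg + 1 = q - 1) :
    (freeAInf Q).bWord v.word q h = v.sgn • freeLetter Q q (.node v.trees) v.path v.elt := by
  match v with
  | single t w h ξ => simp [trees] at hv
  | cons t w hw ξ v =>
    have h1 : (freeAInf Q).bWord (cons t w hw ξ v).word q h =
      (DirectSum.toModule k _ _ fun i : List PTree × DegPath Q.Obj X Y =>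
        freeLetter Q q (PTree.node i.1) i.2) (freeConcat Q (cons t w hw ξ v).word.shape
          (cons t w hw ξ v).word.tprod) := rfl
    rw [h1, freeConcat_word]
    rw [Units.smul_def, map_zsmul]
    erw [DirectSum.toModule_lof]
    rfl

end TreeWord

/-- The family `Φ` is defined on the whole tensor algebra, free of degrees, and only has to agree
with `L` on the summands that exist. This form allows `b₁` to be followed by any additive map
without transporting between graded components. -/
theorem map_freeB₁ {N : Type*} [AddCommGroup N] {X Y : Q.Obj} {p q : ℤ} (hpq : q = p + 1)
    {t : PTree} {w : DegPath Q.Obj X Y} (h : IsFreeIndex p t w) (ξ : Q.toGraded.tensor w)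
    (L : (freeAInf Q).Hom X Y q →+ N) (Φ : PTree → Q.toGraded.Total X Y →+ N)
    (hΦ : ∀ t' w' ξ', IsFreeIndex q t' w' →
      L (freeLetter Q q t' w' ξ') = Φ t' (Q.toGraded.totalι w' ξ')) :
    L (freeB₁ Q p q (freeLetter Q p t w ξ)) = t.sign • Φ t (tensorD Q w ξ) -
      PTree.expandSum (fun s => Φ s (Q.toGraded.totalι w ξ)) t := by
  have h1 : freeB₁ Q p q (freeLetter Q p t w ξ) =
      t.sign • (DirectSum.toModule k _ _ fun w' => freeLetter Q q t w') (tensorD Q w ξ) +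
      (t.expand.map fun e => ((1 + e.2 : ℕ) : ℤ).negOnePow • freeLetter Q q e.1 w ξ).sum := by
    rw [freeLetter_eq Q h, freeB₁]
    erw [DirectSum.toModule_lof]
    rw [LinearMap.add_apply]
    congr 1
    induction t.expand with
    | nil => rfl
    | cons e l ih =>
      simp only [List.map_cons, List.sum_cons, LinearMap.add_apply]
      rw [ih]
      rfl
  -- Off the admissible pairs `freeLetter` is zero while `Φ` is unconstrained; the differential
  -- keeps the length and raises the degree by one, so only admissible pairs occur.
  have h2 : ∀ a ∈ Q.toGraded.totalDeg X Y w.length (w.sdeg + 1),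
      L ((DirectSum.toModule k _ _ fun w' => freeLetter Q q t w') a) = Φ t a := by
    intro a ha
    induction ha using AddSubgroup.closure_induction with
    | zero => simp only [map_zero]
    | add x y _ _ hx hy => simp only [map_add, hx, hy]
    | neg x _ hx => simp only [map_neg, hx]
    | mem x hx =>
      obtain ⟨w', ξ', hl, hd, rfl⟩ := hx
      rw [← hΦ t w' ξ' ⟨h.1, by rw [hl, h.2.1], by rw [hd, hpq]; linarith [h.2.2]⟩]
      simp only [totalι]
      erw [DirectSum.toModule_lof]
  rw [h1, map_add, Units.smul_def, map_zsmul, h2, ← Units.smul_def, sub_eq_add_neg]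
  · congr 1
    rw [map_list_sum, List.map_map, PTree.expandSum, ← neg_one_smul ℤ, List.smul_sum, List.map_map]
    congr 1
    refine List.map_congr_left fun e he => ?_
    obtain ⟨h3, h4, h5⟩ := PTree.expand_spec t e he
    simp only [Function.comp, Units.smul_def, map_zsmul]
    rw [hΦ e.1 w ξ ⟨h5 h.1, by rw [h4, h.2.1], by rw [h3, hpq]; push_cast; linarith [h.2.2]⟩]
    simp [Int.negOnePow_add]
  · rw [← totalD_totalι]
    exact totalD_mem Q (totalι_mem_totalDeg (A := Q.toGraded) w ξ)

/-! ### The A∞-equations of the free A∞-category -/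

namespace TreeWord

variable {Q} {X Y Z : Q.Obj} {N : Type u} [AddCommGroup N]

/-- `cutSum` also counts the two cuts with an empty piece, which `splitSum` omits. -/
theorem splitSum_word (G : ∀ Z : Q.Obj, (freeAInf Q).Word X Z → (freeAInf Q).Word Z Y → N)
    (g : List PTree → List PTree → N) (v : TreeWord Q X Y)
    (h : ∀ (Z : Q.Obj) (v₁ : TreeWord Q X Z) (v₂ : TreeWord Q Z Y), v₁.append v₂ = v →
      G Z v₁.word v₂.word = g v₁.trees v₂.trees) :
    g [] v.trees + Word.splitSum (A := (freeAInf Q).toGradedQuiver) G v.word + g v.trees [] =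
      PTree.cutSum g v.trees := by
  induction v generalizing g with
  | single t w ht ξ => simp [word, Word.splitSum, trees, PTree.cutSum]
  | @cons X Z Y p t w ht ξ v ih =>
    have h1 := ih (fun Z' v₁ z => G Z' (Word.cons (freeLetter Q p t w ξ) v₁) z)
      (fun a b => g (t :: a) b) fun Z' v₁ v₂ e => h Z' (cons t w ht ξ v₁) v₂ (by rw [append, e])
    simp only [word, Word.splitSum, trees, PTree.cutSum]
    rw [← h1, show G Z (Word.single (freeLetter Q p t w ξ)) v.word = g [t] v.trees from
      h Z (single t w ht ξ) v rfl]
    simp only [← add_assoc]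
    rfl

/-- The part of the differential of `v.total` that comes from the first letter. -/
def headD : {X Y : Q.Obj} → TreeWord Q X Y → Q.toGraded.Total X Y
  | _, _, single _ w _ ξ => tensorD Q w ξ
  | _, _, cons _ w _ ξ v => v.path.sdeg.negOnePow • Q.toGraded.mulTotal (tensorD Q w ξ) v.total

theorem total_mem (v : TreeWord Q X Y) :
    v.total ∈ Q.toGraded.totalDeg X Y v.path.length v.path.sdeg :=
  totalι_mem_totalDeg (A := Q.toGraded) v.path v.elt

theorem totalD_cons {p : ℤ} (t : PTree) (w : DegPath Q.Obj X Z) (h : IsFreeIndex p t w)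
    (ξ : Q.toGraded.tensor w) (v : TreeWord Q Z Y) :
    totalD Q (cons t w h ξ v).total = (cons t w h ξ v).headD +
      Q.toGraded.mulTotal (Q.toGraded.totalι w ξ) (totalD Q v.total) := by
  rw [total_cons, totalD_mul Q _ v.total_mem, totalD_totalι]
  rfl

theorem length_trees_pos (v : TreeWord Q X Y) : 1 ≤ v.trees.length := by
  cases v <;> simp [trees]

theorem map_bVal_word (v : TreeWord Q X Y) (L : (freeAInf Q).Hom X Y (v.word.sdeg + 2) →+ N)
    (Φ : PTree → Q.toGraded.Total X Y →+ N)
    (hΦ : ∀ t' w' ξ', IsFreeIndex (v.word.sdeg + 2) t' w' →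
      L (freeLetter Q _ t' w' ξ') = Φ t' (Q.toGraded.totalι w' ξ')) :
    L ((freeAInf Q).bVal v.word) = v.sgn • (PTree.corolla (fun s => Φ s v.total) v.trees +
      PTree.only (fun t => t.sign • Φ t (totalD Q v.total)) v.trees) := by
  by_cases hv : 2 ≤ v.trees.length
  · rw [PTree.corolla_of_two_le _ hv, PTree.only_of_two_le _ hv, add_zero,
      show (freeAInf Q).bVal v.word = _ from bWord_word v hv (by ring), Units.smul_def, map_zsmul, hΦ _ _ _ (isFreeIndex_node v hv (by ring))]
    rfl
  · match v with
    | cons t w h ξ v =>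
      have := v.length_trees_pos
      simp only [trees, List.length_cons] at hv
      omega
    | @single _ _ _ _ _ p t w h ξ =>
      have := map_freeB₁ Q (q := p - 1 + 2) (by ring) h ξ L Φ hΦ
      refine this.trans ?_
      rw [← totalD_totalι]
      simp only [sgn, trees, PTree.corolla, PTree.only, one_smul, total, path, elt]
      exact sub_eq_neg_add _ _

/-- All terms in which the operation involves the first letter, with the sign of the word pulled
out: the internal differential of that letter, plus collapses of initial runs of trees. -/
theorem headSum_word {F : (freeAInf Q).Word X Y → N} (hF : Word.IsAdditive F)
    (H : List PTree → Q.toGraded.Total X Y →+ N) (v : TreeWord Q X Y)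
    (hH : ∀ v' : TreeWord Q X Y, v'.word.sdeg = v.word.sdeg + 1 →
      F v'.word = v'.sgn • H v'.trees v'.total) :
    (freeAInf Q).headSum F v.word = v.sgn • (PTree.forestSign v.trees • H v.trees v.headD +
      PTree.cutSum (fun a z => PTree.corolla (fun s => H (s :: z) v.total) a) v.trees) := by
  -- The term with `only` is present just when the initial run is one letter, where `b₁` also
  -- contains the internal differential.
  set g : List PTree → List PTree → N := fun a z => v.sgn • (PTree.corolla
    (fun s => H (s :: z) v.total) a +
      PTree.only (fun _ => PTree.forestSign v.trees • H v.trees v.headD) a) with hg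
  have hwhole : F (.single ((freeAInf Q).bVal v.word)) = g v.trees [] := by
    obtain ⟨L, hL⟩ := hF.single (p := v.word.sdeg + 2)
    rw [hL, map_bVal_word v L (fun s => H [s]) fun t' w' ξ' h' => by
      rw [← hL]
      refine (hH (single t' w' h' ξ') ?_).trans (one_smul _ _)
      change v.word.sdeg + 2 - 1 = v.word.sdeg + 1
      ring]
    rw [hg]
    congr 2
    match v with
    | single t w h ξ =>
      simp only [trees, PTree.only, headD, PTree.forestSign_cons, PTree.forestSign_nil, mul_one]
      congr 2
      exact totalD_totalι Q w ξ
    | cons t w h ξ v =>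
      have : 2 ≤ (cons t w h ξ v).trees.length := by
        have := v.length_trees_pos
        simp only [trees, List.length_cons]
        omega
      rw [PTree.only_of_two_le _ this, PTree.only_of_two_le _ this]
  have hsplit := splitSum_word (fun _ v z => z.sdeg.negOnePow •
    F (.cons ((freeAInf Q).bVal v) z)) g v ?_
  · have h0 : (freeAInf Q).headSum F v.word = F (.single ((freeAInf Q).bVal v.word)) +
      Word.splitSum (fun _ v z => z.sdeg.negOnePow • F (.cons ((freeAInf Q).bVal v) z)) v.word := rfl
    have h1 : g [] v.trees = 0 := by simp [hg, PTree.only]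
    have h2 : PTree.cutSum (fun a _ => PTree.only
        (fun _ => PTree.forestSign v.trees • H v.trees v.headD) a) v.trees =
          PTree.forestSign v.trees • H v.trees v.headD := by
      match v.trees, v.length_trees_pos with
      | t :: ts, _ => exact PTree.cutSum_only (fun _ _ => _) t ts
    rw [h1, zero_add] at hsplit
    rw [h0, hwhole]
    refine ((add_comm _ _).trans hsplit).trans ?_
    rw [hg, PTree.cutSum_smul, PTree.cutSum_add, h2, add_comm]
  · rintro Z v₁ v₂ rfl
    obtain ⟨L, hL⟩ := hF.cons_left (p := v₁.word.sdeg + 2) v₂.word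
    rw [hL, map_bVal_word v₁ L (fun s => (DistribSMul.toAddMonoidHom N
      (((s.internal : ℤ) * v₂.word.sdeg).negOnePow * v₂.sgn)).comp ((H (s :: v₂.trees)).comp
        (Q.toGraded.mulTotal.flip v₂.total).toAddMonoidHom)) fun t' w' ξ' h' => by
      rw [← hL]
      refine (hH (cons t' w' h' ξ' v₂) ?_).trans ?_
      · rw [word_sdeg_cons, sdeg_append]
        ring
      · rw [total_cons]
        rfl]
    simp only [AddMonoidHom.comp_apply, DistribSMul.toAddMonoidHom_apply, mul_smul,
      PTree.corolla_negOnePow_smul, LinearMap.toAddMonoidHom_coe, LinearMap.flip_apply,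
      ← total_append, hg, sgn_append, PTree.corolla_smul, smul_add]
    congr 1
    · simp only [smul_smul]
      congr 1
      -- The operation passing `v₂` and the one internal vertex it creates each give the sign of the
      -- degree of `v₂`; the two cancel.
      rw [add_mul, one_mul, Int.negOnePow_add]
      rw [show v₂.word.sdeg.negOnePow * (v₁.sgn * (((PTree.forestInternal v₁.trees : ℤ) *
        v₂.word.sdeg).negOnePow * v₂.word.sdeg.negOnePow * v₂.sgn)) =
        (v₂.word.sdeg.negOnePow * v₂.word.sdeg.negOnePow) * (((PTree.forestInternal v₁.trees : ℤ) *
        v₂.word.sdeg).negOnePow * v₁.sgn * v₂.sgn) by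
          simp only [mul_comm, mul_left_comm, mul_assoc], Int.units_mul_self, one_mul, mul_assoc]
    · by_cases hv : 2 ≤ v₁.trees.length
      · rw [PTree.only_of_two_le _ hv, PTree.only_of_two_le _ hv]
        simp only [smul_zero]
      · match v₁ with
        | cons t w h ξ v =>
          have := v.length_trees_pos
          simp only [trees, List.length_cons] at hv
          omega
        | single t w h ξ =>
          have h1 : (single t w h ξ).trees = [t] := rfl
          have h2 : (append (single t w h ξ) v₂).trees = t :: v₂.trees := rfl
          have h3 : (append (single t w h ξ) v₂).headD =
            v₂.path.sdeg.negOnePow • Q.toGraded.mulTotal (tensorD Q w ξ) v₂.total := rfl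
          have h4 : totalD Q (single t w h ξ).total = tensorD Q w ξ := totalD_totalι Q w ξ
          have h5 : (single t w h ξ).sgn = 1 := rfl
          rw [h1, h2, h3, h4, h5]
          simp only [PTree.only, PTree.forestInternal, add_zero, ← v₂.sdeg_path,
            PTree.forestSign_cons, Units.smul_def (v₂.path.sdeg.negOnePow), map_zsmul]
          simp only [← Units.smul_def, smul_smul, Int.negOnePow_add, one_mul, PTree.forestSign]
          congr 1
          simp only [mul_comm, mul_left_comm, mul_assoc]

/-- The operator of the A∞-equations becomes the sum of the tensor differential and `coder`;
repeated on `F = bTotal` it reduces those equations to identities about each part. -/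
theorem bSum_word {F : (freeAInf Q).Word X Y → N} (hF : Word.IsAdditive F)
    (H : List PTree → Q.toGraded.Total X Y →+ N) (v : TreeWord Q X Y)
    (hH : ∀ v' : TreeWord Q X Y, v'.word.sdeg = v.word.sdeg + 1 →
      F v'.word = v'.sgn • H v'.trees v'.total) :
    (freeAInf Q).bSum F v.word =
      v.sgn • (PTree.forestSign v.trees • H v.trees (totalD Q v.total) +
        PTree.coder (fun us => H us v.total) v.trees) := by
  induction v with
  | single t w h ξ =>
    refine (headSum_word hF H (single t w h ξ) hH).trans ?_
    simp only [sgn, trees, headD, total, PTree.coder, smul_zero, add_zero, path, elt]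
    congr 4
    exact (totalD_totalι Q w ξ).symm
  | @cons X Z Y p t w h ξ v ih =>
    have h1 := headSum_word hF H (cons t w h ξ v) hH
    -- After an operation the tail has degree one higher, so the shift of `t` passes it with an
    -- extra sign (-1)^{|t|}; this is the sign in the recursion of `coder`.
    have h2 := ih (hF.cons (freeLetter Q p t w ξ))
      (fun us => (DistribSMul.toAddMonoidHom N
        ((t.internal : ℤ) * (v.word.sdeg + 1)).negOnePow).comp
          ((H (t :: us)).comp (Q.toGraded.mulTotal (Q.toGraded.totalι w ξ)).toAddMonoidHom))
      fun v' hv' => by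
        refine (hH (cons t w h ξ v') (by rw [word_sdeg_cons, word_sdeg_cons, hv']; ring)).trans ?_
        rw [sgn, trees, total_cons, hv', mul_comm, mul_smul]
        rfl
    have h3 : (freeAInf Q).bSum F (cons t w h ξ v).word =
      (freeAInf Q).headSum F (cons t w h ξ v).word +
        (freeAInf Q).bSum (fun w' => F (.cons (freeLetter Q p t w ξ) w')) v.word := rfl
    have h4 : (cons t w h ξ v).trees = t :: v.trees := rfl
    have h5 : (cons t w h ξ v).sgn = ((t.internal : ℤ) * v.word.sdeg).negOnePow * v.sgn := rfl
    rw [h3, h1, h2, totalD_cons, map_add, h4, h5, PTree.coder]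
    simp only [AddMonoidHom.comp_apply, DistribSMul.toAddMonoidHom_apply, PTree.coder_smul,
      LinearMap.toAddMonoidHom_coe, ← total_cons _ _ h, PTree.forestSign_cons, mul_add, mul_one,
      Int.negOnePow_add, smul_add, smul_smul, PTree.sign]
    simp only [mul_comm, mul_left_comm, mul_assoc]
    abel

variable (Q) in
/-- The inclusion of the summands of `FQ(X, Y)` that belong to one tree. -/
def treeι (X Y : Q.Obj) (t : PTree) :
    Q.toGraded.Total X Y →ₗ[k] ⨁ q, (freeAInf Q).Hom X Y q :=
  DirectSum.toModule k _ _ fun w =>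
    (DirectSum.lof k ℤ (fun q => (freeAInf Q).Hom X Y q) (w.sdeg + t.internal + 1)).comp
      (freeLetter Q _ t w)

theorem of_freeLetter {q : ℤ} {t : PTree} {w : DegPath Q.Obj X Y} (h : IsFreeIndex q t w)
    (ξ : Q.toGraded.tensor w) :
    DirectSum.of (fun q => (freeAInf Q).Hom X Y q) q (freeLetter Q q t w ξ) =
      treeι Q X Y t (Q.toGraded.totalι w ξ) := by
  obtain rfl : q = w.sdeg + t.internal + 1 := by linarith [h.2.2]
  simp only [treeι, totalι]
  erw [DirectSum.toModule_lof]
  rfl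

theorem bTotal_word (v : TreeWord Q X Y) :
    (freeAInf Q).bTotal v.word = v.sgn • (PTree.corolla (fun s => treeι Q X Y s v.total) v.trees +
      PTree.only (fun t => t.sign • treeι Q X Y t (totalD Q v.total)) v.trees) :=
  map_bVal_word v (DirectSum.of (fun q => (freeAInf Q).Hom X Y q) (v.word.sdeg + 2))
    (fun s => (treeι Q X Y s).toAddMonoidHom) fun _ _ ξ' h' => of_freeLetter h' ξ'

theorem bSum_bTotal_word (v : TreeWord Q X Y) :
    (freeAInf Q).bSum (freeAInf Q).bTotal v.word = 0 := by
  have h := bSum_word (AInfData.isAdditive_bTotal _) (fun us =>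
    { toFun x := PTree.corolla (fun s => treeι Q X Y s x) us +
        PTree.only (fun t => t.sign • treeι Q X Y t (totalD Q x)) us
      map_zero' := by
        simp only [map_zero, smul_zero]
        match us with
        | [] => simp [PTree.only]
        | [t] => simp [PTree.only, PTree.corolla, PTree.expandSum]
        | t :: s :: ts => simp [PTree.only, PTree.corolla]
      map_add' x y := by
        simp only [map_add, smul_add, PTree.corolla_add]
        match us with
        | [] => simp [PTree.only]
        | [t] => simp only [PTree.only]; abel
        | t :: s :: ts => simp only [PTree.only]; abel }) v fun v' _ => bTotal_word v'
  rw [h]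
  simp only [AddMonoidHom.coe_mk, ZeroHom.coe_mk, totalD_totalD, map_zero, smul_zero,
    PTree.coder_add]
  have h1 : PTree.only (fun _ => (0 : ⨁ q, (freeAInf Q).Hom X Y q)) v.trees = 0 := by
    match v.trees with
    | [] => rfl
    | [t] => rfl
    | t :: s :: ts => rfl
  have h2 : PTree.coder (PTree.corolla fun s => treeι Q X Y s v.total) v.trees = 0 := by
    have hr := v.trees_reduced
    match v.trees, hr with
    | [], _ => rfl
    | [t], hr => rw [PTree.coder_corolla_singleton, PTree.expandSum_expandSum t _ hr.1]
    | t :: s :: ts, _ => exact PTree.coder_corolla _ _ (by simp)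
  -- The mixed terms: differentiating after the tree operation and before it give opposite signs by
  -- `corolla_sign_smul`.
  have h3 := PTree.coder_only (fun t => t.sign • treeι Q X Y t (totalD Q v.total)) v.trees
  rw [PTree.corolla_sign_smul] at h3
  rw [h1, add_zero]
  erw [h2, h3]
  simp

end TreeWord

variable {Q} in
theorem TreeWord.exists_word_eq {X Y : (freeAInf Q).Obj} (w : (freeAInf Q).Word X Y)
    (hw : w.All fun X Y q x => x ∈ {x : (freeAInf Q).Hom X Y q | ∃ (t : PTree)
      (w : DegPath Q.Obj X Y) (ξ : Q.toGraded.tensor w),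
        IsFreeIndex q t w ∧ x = freeLetter Q q t w ξ}) :
    ∃ v : TreeWord Q X Y, v.word = w := by
  induction w with
  | single x =>
    obtain ⟨t, w, ξ, h, rfl⟩ := hw
    exact ⟨.single t w h ξ, rfl⟩
  | cons x w ih =>
    obtain ⟨⟨t, w, ξ, h, rfl⟩, hw⟩ := hw
    obtain ⟨v, rfl⟩ := ih hw
    exact ⟨.cons t w h ξ v, rfl⟩

/-- The free A∞-category satisfies the A∞-equations. -/
theorem isAInf_freeAInf : (freeAInf Q).IsAInf := by
  intro X Y w
  refine Word.eq_zero_of_all (A := (freeAInf Q).toGradedQuiver) (closure_freeLetter Q)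
    ((freeAInf Q).isMultiadditive_bSum (AInfData.isAdditive_bTotal _)) (fun w hw => ?_) w
  obtain ⟨v, rfl⟩ := TreeWord.exists_word_eq w hw
  exact v.bSum_bTotal_word

end

open scoped Classical
open GradedQuiver

/-! ### Maps of graded quivers with operations -/

namespace GradedQuiver.Word

variable {k : Type u} [CommRing k] {A B : GradedQuiver k}

theorem splitSum_map_hom {N N' : Type u} [AddCommGroup N] [AddCommGroup N'] (L : N →+ N')
    {X Y : A.Obj} (G : ∀ Z : A.Obj, A.Word X Z → A.Word Z Y → N) (w : A.Word X Y) :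
    splitSum (fun Z v z => L (G Z v z)) w = L (splitSum G w) := by
  induction w with
  | single x => simp [splitSum]
  | cons x w ih => simp only [splitSum, ih, map_add]

variable {f : A.Obj → B.Obj} {f₁ : ∀ (X Y : A.Obj) (p : ℤ), A.Hom X Y p →ₗ[k] B.Hom (f X) (f Y) p}
  {N : Type u} [AddCommGroup N] {P : ∀ (X Y : A.Obj) (p : ℤ), A.Hom X Y p → Prop}

theorem splitSum_map {X Y : A.Obj} (G : ∀ Z : A.Obj, A.Word X Z → A.Word Z Y → N)
    (G' : ∀ Z : B.Obj, B.Word (f X) Z → B.Word Z (f Y) → N)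
    (h : ∀ Z v z, v.All P → G Z v z = G' (f Z) (v.map f f₁) (z.map f f₁)) (w : A.Word X Y)
    (hw : w.All P) : splitSum G w = splitSum G' (w.map f f₁) := by
  induction w with
  | single x => rfl
  | cons x w ih =>
    simp only [splitSum, Word.map]
    rw [h _ (.single x) w hw.1, ih _ (fun Z v z => G' Z (Word.cons (f₁ _ _ _ x) v) z)
      (fun Z v z hv => h Z (.cons x v) z ⟨hw.1, hv⟩) hw.2]
    rfl

theorem map_congr_of_all {X Y : A.Obj}
    {g₁ : ∀ (X Y : A.Obj) (p : ℤ), A.Hom X Y p →ₗ[k] B.Hom (f X) (f Y) p} (w : A.Word X Y)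
    (hw : w.All fun X Y p x => f₁ X Y p x = g₁ X Y p x) : w.map f f₁ = w.map f g₁ := by
  induction w with
  | single x => simp only [Word.map]; rw [show f₁ _ _ _ x = g₁ _ _ _ x from hw]
  | cons x w ih => simp only [Word.map]; rw [hw.1, ih hw.2]

theorem eq_zero_of_all_cons {S : ∀ (X Y : A.Obj) (p : ℤ), Set (A.Hom X Y p)}
    (hS : ∀ X Y p, AddSubgroup.closure (S X Y p) = ⊤) {X Y Z : A.Obj} {F : A.Word X Y → N}
    (hF : IsMultiadditive F) (h : ∀ {Z : A.Obj} {p : ℤ} (x : A.Hom X Z p) (w : A.Word Z Y),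
      (Word.cons x w).All (fun X Y p x => x ∈ S X Y p) → F (.cons x w) = 0)
    {p : ℤ} (x : A.Hom X Z p) (w : A.Word Z Y) : F (.cons x w) = 0 := by
  -- `AddRel` preserves the number of letters, so resetting `F` to zero on one-letter words keeps it
  -- additive.
  let F' : A.Word X Y → N := fun w => match w with
    | .single _ => 0
    | .cons x w => F (.cons x w)
  have hF' : IsMultiadditive F' := by
    intro w w' w'' h
    cases h with
    | single x y => exact (add_zero _).symm
    | head x y w => exact hF _ _ _ (.head x y w)
    | tail x h => exact hF _ _ _ (.tail x h)
  refine eq_zero_of_all hS hF' (fun w hw => ?_) (.cons x w)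
  cases w with
  | single x => rfl
  | cons x w => exact h x w hw

end GradedQuiver.Word

namespace AInfData

variable {k : Type u} [CommRing k] {A B : AInfData k}

theorem bSum_map_hom {N N' : Type u} [AddCommGroup N] [AddCommGroup N'] (L : N →+ N')
    {X Y : A.Obj} (F : A.Word X Y → N) (w : A.Word X Y) :
    A.bSum (fun w => L (F w)) w = L (A.bSum F w) := by
  have h : ∀ {X Y : A.Obj} (F : A.Word X Y → N) (w : A.Word X Y),
      A.headSum (fun w => L (F w)) w = L (A.headSum F w) := by
    intro X Y F w
    simp only [headSum, map_add, ← Word.splitSum_map_hom, Units.smul_def, map_zsmul]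
  induction w with
  | single x => exact h F _
  | cons x w ih => simp only [bSum, h, ih, map_add]

theorem cons_bVal {X Y Z : A.Obj} (v : A.Word X Z) (z : A.Word Z Y) (q : ℤ)
    (h : v.sdeg + 1 = q - 1) : Word.cons (A.bVal v) z = Word.cons (A.bWord v q h) z := by
  obtain rfl : q = v.sdeg + 2 := by omega
  rfl

theorem single_bVal {X Z : A.Obj} (v : A.Word X Z) (q : ℤ)
    (h : v.sdeg + 1 = q - 1) : Word.single (A.bVal v) = Word.single (A.bWord v q h) := by
  obtain rfl : q = v.sdeg + 2 := by omega
  rfl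

variable (f : A.Obj → B.Obj)
  (f₁ : ∀ (X Y : A.Obj) (p : ℤ), A.Hom X Y p →ₗ[k] B.Hom (f X) (f Y) p)

/-- The equation `f₁^{⊗ n} bₙ = bₙ f₁`, evaluated on a word. -/
def Commutes {X Y : A.Obj} (w : A.Word X Y) : Prop :=
  ∀ (q : ℤ) (h : w.sdeg + 1 = q - 1),
    B.bWord (w.map f f₁) q (by rw [Word.sdeg_map, h]) = f₁ X Y q (A.bWord w q h)

/-- The map of the direct sums of the graded components. -/
def sumMap (X Y : A.Obj) : (⨁ q, A.Hom X Y q) →+ ⨁ q, B.Hom (f X) (f Y) q :=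
  DirectSum.toAddMonoid fun q =>
    (DirectSum.of (fun q => B.Hom (f X) (f Y) q) q).comp (f₁ X Y q).toAddMonoidHom

theorem sumMap_of {X Y : A.Obj} (q : ℤ) (x : A.Hom X Y q) :
    sumMap f f₁ X Y (DirectSum.of (fun q => A.Hom X Y q) q x) =
      DirectSum.of (fun q => B.Hom (f X) (f Y) q) q (f₁ X Y q x) := by
  simp only [sumMap, DirectSum.toAddMonoid_of]
  rfl

theorem commutes_iff {X Y : A.Obj} (w : A.Word X Y) :
    Commutes f f₁ w ↔ sumMap f f₁ X Y (A.bTotal w) = B.bTotal (w.map f f₁) := by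
  constructor
  · intro h
    rw [bTotal, sumMap_of, bVal, ← h, of_bWord]
  · intro h q hq
    rw [← A.of_bWord w q hq, sumMap_of,
      ← B.of_bWord (w.map f f₁) q (by rw [Word.sdeg_map, hq])] at h
    exact (DirectSum.of_injective (β := fun q => B.Hom (f X) (f Y) q) q h).symm

variable {f f₁} {N : Type u} [AddCommGroup N]
  {P : ∀ (X Y : A.Obj) (p : ℤ), A.Hom X Y p → Prop}

theorem splitSum_commutes (hP : ∀ {X Y : A.Obj} (v : A.Word X Y), v.All P → Commutes f f₁ v)
    {X Y : A.Obj} {F : A.Word X Y → N} {F' : B.Word (f X) (f Y) → N}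
    (hF : ∀ {Z : A.Obj} {p : ℤ} (x : A.Hom X Z p) (u : A.Word Z Y),
      F (.cons x u) = F' ((Word.cons x u).map f f₁)) (w : A.Word X Y) (hw : w.All P) :
    Word.splitSum (fun _ v z => z.sdeg.negOnePow • F (.cons (A.bVal v) z)) w =
      Word.splitSum (fun _ v z => z.sdeg.negOnePow • F' (.cons (B.bVal v) z)) (w.map f f₁) := by
  refine Word.splitSum_map _ (fun _ v z => z.sdeg.negOnePow • F' (.cons (B.bVal v) z))
    (fun Z v z hv => ?_) w hw
  rw [hF, Word.sdeg_map, B.cons_bVal (v.map f f₁) (z.map f f₁) (v.sdeg + 2)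
    (by rw [Word.sdeg_map]; ring), hP v hv (v.sdeg + 2) (by ring)]
  rfl

theorem bSum_commutes (hP : ∀ {X Y : A.Obj} (v : A.Word X Y), v.All P → Commutes f f₁ v)
    {X Y : A.Obj} {F : A.Word X Y → N} {F' : B.Word (f X) (f Y) → N}
    (hF : ∀ u, F u = F' (u.map f f₁)) (w : A.Word X Y) (hw : w.All P) :
    A.bSum F w = B.bSum F' (w.map f f₁) := by
  have h : ∀ {X Y : A.Obj} {F : A.Word X Y → N} {F' : B.Word (f X) (f Y) → N}
      (_ : ∀ u, F u = F' (u.map f f₁)) (w : A.Word X Y) (_ : w.All P),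
      A.headSum F w = B.headSum F' (w.map f f₁) := by
    intro X Y F F' hF w hw
    rw [headSum, headSum, splitSum_commutes hP (fun x u => hF _) w hw, hF,
      B.single_bVal (w.map f f₁) (w.sdeg + 2) (by rw [Word.sdeg_map]; ring),
      hP w hw (w.sdeg + 2) (by ring)]
    rfl
  induction w with
  | single x => exact h hF _ hw
  | cons x w ih =>
    simp only [bSum, Word.map]
    rw [h hF _ hw, ih (F := fun w' => F (Word.cons x w'))
      (F' := fun w' => F' (Word.cons (f₁ _ _ _ x) w')) (fun u => hF _) hw.2]
    rfl

/-- In the A∞-equation for `cons x w`, one term applies bₙ to the whole word and then b₁. Every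
other term is known to be compatible with the map, hence so is this one. -/
theorem commutes_single_bWord (hA : A.IsAInf) (hB : B.IsAInf)
    (hc : ∀ {X Z Y : A.Obj} {p : ℤ} (x : A.Hom X Z p) (w : A.Word Z Y),
      Commutes f f₁ (.cons x w))
    {X Y Z : A.Obj} {p : ℤ} (x : A.Hom X Z p) (w : A.Word Z Y)
    (hw : (Word.cons x w).All fun _ _ _ y => Commutes f f₁ (.single y)) (q : ℤ)
    (hq : (Word.cons x w).sdeg + 1 = q - 1) :
    Commutes f f₁ (.single (A.bWord (.cons x w) q hq)) := by
  have hP : ∀ {X Y : A.Obj} (v : A.Word X Y), (v.All fun _ _ _ y => Commutes f f₁ (.single y)) →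
      Commutes f f₁ v := by
    intro X Y v hv
    cases v with
    | single y => exact hv
    | cons y v => exact hc y v
  have hF : ∀ {Z : A.Obj} {p : ℤ} (x : A.Hom X Z p) (u : A.Word Z Y),
      sumMap f f₁ X Y (A.bTotal (.cons x u)) = B.bTotal ((Word.cons x u).map f f₁) :=
    fun x u => (commutes_iff f f₁ _).1 (hc x u)
  have h1 := bSum_map_hom (sumMap f f₁ X Y) A.bTotal (.cons x w)
  rw [show A.bSum A.bTotal (.cons x w) = 0 from hA X Y _, map_zero] at h1
  have h2 : B.bSum B.bTotal ((Word.cons x w).map f f₁) = 0 := hB _ _ _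
  simp only [Word.map] at h2
  simp only [bSum, headSum] at h1 h2
  rw [splitSum_commutes (F := fun u => sumMap f f₁ X Y (A.bTotal u)) (F' := B.bTotal) hP hF _ hw,
    bSum_commutes hP (F := fun w' => sumMap f f₁ X Y (A.bTotal (.cons x w'))) (F' := fun w' => B.bTotal (.cons (f₁ _ _ _ x) w')) (fun u => hF x u) w hw.2] at h1
  rw [commutes_iff]
  have h3 : B.bTotal (.single (B.bVal ((Word.cons x w).map f f₁))) =
      B.bTotal ((Word.single (A.bVal (.cons x w))).map f f₁) := by
    rw [B.single_bVal _ ((Word.cons x w).sdeg + 2) (by rw [Word.sdeg_map]; ring),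
      hc x w _ (by ring)]
    rfl
  rw [← A.single_bVal, ← h3]
  -- The image of the equation in `A` and the equation in `B` agree except in that one term.
  exact add_right_cancel (add_right_cancel (h1.trans h2.symm))

end AInfData

open scoped Classical
open GradedQuiver

/-! ### Generation of the free A∞-category -/

namespace PTree

mutual
theorem leaves_pos : ∀ t : PTree, t.Reduced → 1 ≤ t.leaves
  | leaf, _ => le_rfl
  | node ts, h => by
    simp only [Reduced] at h
    rw [leaves]
    exact forestLeaves_pos ts (by rintro rfl; simp at h) h.2
theorem forestLeaves_pos : ∀ ts : List PTree, ts ≠ [] → ForestReduced ts → 1 ≤ forestLeaves ts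
  | [], h, _ => absurd rfl h
  | t :: ts, _, h => by
    rw [forestLeaves]
    exact (leaves_pos t h.1).trans (Nat.le_add_right _ _)
end

end PTree

theorem DegPath.exists_append {O : Type u} {X Y : O} (w : DegPath O X Y) (n : ℕ) (hn : 1 ≤ n)
    (h : n < w.length) :
    ∃ (Z : O) (v : DegPath O X Z) (z : DegPath O Z Y), v.length = n ∧ w = v.append z := by
  induction w generalizing n with
  | single p => simp only [length] at h; omega
  | @cons X Z Y p w ih =>
    obtain rfl | hn' : n = 1 ∨ 1 ≤ n - 1 := by omega
    · exact ⟨Z, .single p, w, rfl, rfl⟩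
    · simp only [length] at h
      obtain ⟨Z', v, z, hv, rfl⟩ := ih (n - 1) hn' (by omega)
      exact ⟨Z', .cons p v, z, by simp only [length, hv]; omega, rfl⟩

/-- Surjectivity of concatenation from A(v) ⊗ A(z), in the form needed to cut tensors into the
pieces belonging to successive trees. -/
theorem GradedQuiver.totalι_append_mem {k : Type u} [CommRing k] {A : GradedQuiver k}
    {X Y Z : A.Obj} (v : DegPath A.Obj X Z) (z : DegPath A.Obj Z Y)
    (ξ : A.tensor (v.append z)) : A.totalι (v.append z) ξ ∈ AddSubgroup.closure
      {a | ∃ ξ η, a = A.mulTotal (A.totalι v ξ) (A.totalι z η)} := by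
  induction v with
  | @single X Z p =>
    have key : ∀ ξ : A.Hom X Z p ⊗[k] A.tensor z, A.consι p z ξ ∈ AddSubgroup.closure
        {a | ∃ ξ η, a = A.mulTotal (A.totalι (DegPath.single p : DegPath A.Obj X Z) ξ)
          (A.totalι z η)} := by
      intro ξ
      induction ξ using TensorProduct.induction_on with
      | zero => rw [map_zero]; exact zero_mem _
      | tmul x η => exact AddSubgroup.subset_closure ⟨x, η, consι_tmul p z x η⟩
      | add a b ha hb => rw [map_add]; exact add_mem ha hb
    exact key ξ
  | @cons X V Z p v ih =>
    have key : ∀ ξ : A.Hom X V p ⊗[k] A.tensor (v.append z), A.consι p (v.append z) ξ ∈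
        AddSubgroup.closure {a | ∃ ξ η, a = A.mulTotal
          (A.totalι (DegPath.cons p v : DegPath A.Obj X Z) ξ) (A.totalι z η)} := by
      intro ξ
      induction ξ using TensorProduct.induction_on with
      | zero => rw [map_zero]; exact zero_mem _
      | add a b ha hb => rw [map_add]; exact add_mem ha hb
      | tmul x η =>
        rw [consι_tmul]
        have := ih z η
        generalize A.totalι (v.append z) η = a at this ⊢
        induction this using AddSubgroup.closure_induction with
        | zero => rw [map_zero]; exact zero_mem _
        | add a b _ _ ha hb => rw [map_add]; exact add_mem ha hb
        | neg a _ ha => rw [map_neg]; exact neg_mem ha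
        | mem a ha =>
          obtain ⟨ξ, η, rfl⟩ := ha
          rw [← mulTotal_letterι_assoc, ← consι_tmul]
          exact AddSubgroup.subset_closure ⟨_, η, rfl⟩
    exact key ξ

section

variable {k : Type u} [CommRing k] (Q : DGQuiver k)

namespace TreeWord

variable {Q} {X Y : Q.Obj} {P : ∀ (X Y : Q.Obj) (q : ℤ), (freeAInf Q).Hom X Y q → Prop}

/-- `totalι w ξ` is a sum of concatenations of words with the given trees and with letters in `P`. -/
theorem totalι_mem_closure (ts : List PTree) (hne : ts ≠ []) (hr : PTree.ForestReduced ts)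
    (hP : ∀ t ∈ ts, ∀ (X Y : Q.Obj) (q : ℤ) (w : DegPath Q.Obj X Y) (ξ : Q.toGraded.tensor w),
      IsFreeIndex q t w → P X Y q (freeLetter Q q t w ξ))
    (w : DegPath Q.Obj X Y) (hw : PTree.forestLeaves ts = w.length) (ξ : Q.toGraded.tensor w) :
    Q.toGraded.totalι w ξ ∈ AddSubgroup.closure {a | ∃ v : TreeWord Q X Y,
      v.trees = ts ∧ v.path.sdeg = w.sdeg ∧ v.word.All P ∧ a = v.total} := by
  induction ts generalizing X with
  | nil => exact absurd rfl hne
  | cons t ts ih =>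
    by_cases hts : ts = []
    · subst hts
      have h : IsFreeIndex (w.sdeg + t.internal + 1) t w :=
        ⟨hr.1, by simpa [PTree.forestLeaves] using hw, by ring⟩
      exact AddSubgroup.subset_closure ⟨single t w h ξ, rfl, rfl, hP t (by simp) _ _ _ _ _ h, rfl⟩
    · simp only [PTree.forestLeaves] at hw
      have h1 := PTree.forestLeaves_pos ts hts hr.2
      obtain ⟨Z, v, z, hv, rfl⟩ := w.exists_append t.leaves (PTree.leaves_pos t hr.1) (by omega)
      rw [DegPath.length_append, hv] at hw
      have h : IsFreeIndex (v.sdeg + t.internal + 1) t v := ⟨hr.1, hv.symm, by ring⟩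
      have := totalι_append_mem (A := Q.toGraded) v z ξ
      generalize Q.toGraded.totalι (v.append z) ξ = a at this ⊢
      induction this using AddSubgroup.closure_induction with
      | zero => exact zero_mem _
      | add a b _ _ ha hb => exact add_mem ha hb
      | neg a _ ha => exact neg_mem ha
      | mem a ha =>
        obtain ⟨ξ, η, rfl⟩ := ha
        have := ih hts hr.2 (fun t ht => hP t (List.mem_cons_of_mem _ ht)) z (by omega) η
        generalize Q.toGraded.totalι z η = a at this ⊢
        induction this using AddSubgroup.closure_induction with
        | zero => rw [map_zero]; exact zero_mem _
        | add a b _ _ ha hb => rw [map_add]; exact add_mem ha hb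
        | neg a _ ha => rw [map_neg]; exact neg_mem ha
        | mem a ha =>
          obtain ⟨v', rfl, hd, hall, rfl⟩ := ha
          refine AddSubgroup.subset_closure ⟨cons t v h ξ v', rfl, ?_, ⟨hP t (by simp) _ _ _ _ _ h,
            hall⟩, (total_cons t v h ξ v').symm⟩
          rw [path, DegPath.sdeg_append, DegPath.sdeg_append, hd]

end TreeWord

/-- The free A∞-category is generated by `Q` under sums and the operations `bₙ`, `n ≥ 2`. -/
theorem freeAInf_induction {P : ∀ (X Y : Q.Obj) (q : ℤ), (freeAInf Q).Hom X Y q → Prop}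
    (leaf : ∀ (X Y : Q.Obj) (p : ℤ) (x : (Q.Hom X Y).X p), P X Y p (freeLeaf Q X Y p x))
    (add : ∀ (X Y : Q.Obj) (p : ℤ) (x y : (freeAInf Q).Hom X Y p),
      P X Y p x → P X Y p y → P X Y p (x + y))
    (neg : ∀ (X Y : Q.Obj) (p : ℤ) (x : (freeAInf Q).Hom X Y p), P X Y p x → P X Y p (-x))
    (b : ∀ {X Z Y : Q.Obj} {p : ℤ} (x : (freeAInf Q).Hom X Z p) (w : (freeAInf Q).Word Z Y)
      (_ : (Word.cons x w).All P) (q : ℤ) (hq : (Word.cons x w).sdeg + 1 = q - 1),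
      P X Y q ((freeAInf Q).bWord (.cons x w) q hq))
    {X Y : Q.Obj} {q : ℤ} (x : (freeAInf Q).Hom X Y q) : P X Y q x := by
  have zero : ∀ (X Y : Q.Obj) (p : ℤ), P X Y p 0 := fun X Y p => by
    simpa using! leaf X Y p 0
  have letter : ∀ (n : ℕ) (t : PTree), t.internal < n → ∀ (X Y : Q.Obj) (q : ℤ)
      (w : DegPath Q.Obj X Y) (ξ : Q.toGraded.tensor w), IsFreeIndex q t w →
        P X Y q (freeLetter Q q t w ξ) := by
    intro n
    induction n with
    | zero => exact fun t ht => absurd ht (Nat.not_lt_zero _)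
    | succ n ih =>
      intro t ht X Y q w ξ h
      match t with
      | .leaf =>
        match w with
        | .single p =>
          obtain rfl : p = q := by
            have := h.2.2
            simp only [DegPath.sdeg, PTree.internal, Nat.cast_zero] at this
            omega
          exact leaf X Y p ξ
        | .cons p w =>
          have h1 := h.2.1
          have h2 : 1 ≤ w.length := by cases w <;> simp [DegPath.length]
          simp only [PTree.leaves, DegPath.length] at h1
          omega
      | .node ts =>
        rw [PTree.internal_node] at ht
        -- Carries the decomposition of tensors into concatenated words over to the summand of `node
        -- ts`.
        let Λ : Q.toGraded.Total X Y →ₗ[k] (freeAInf Q).Hom X Y q :=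
          DirectSum.toModule k _ _ fun w => freeLetter Q q (.node ts) w
        have hΛ : ∀ w ξ, Λ (Q.toGraded.totalι w ξ) = freeLetter Q q (.node ts) w ξ := by
          intro w ξ
          simp only [Λ, totalι]
          erw [DirectSum.toModule_lof]
        have hlen : 2 ≤ ts.length := h.1.1
        have hmem : ∀ t ∈ ts, t.internal ≤ PTree.forestInternal ts := by
          clear * -
          induction ts with
          | nil => simp
          | cons s ts ih =>
            intro t ht
            rw [PTree.forestInternal]
            rcases List.mem_cons.1 ht with rfl | ht
            · omega
            · exact (ih t ht).trans (Nat.le_add_left _ _)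
        have hcl := TreeWord.totalι_mem_closure (P := P) ts (by rintro rfl; simp at hlen) h.1.2
          (fun t ht' => ih t (by have := hmem t ht'; omega)) w h.2.1 ξ
        rw [← hΛ]
        generalize Q.toGraded.totalι w ξ = a at hcl ⊢
        induction hcl using AddSubgroup.closure_induction with
        | zero => rw [map_zero]; exact zero _ _ _
        | add a b _ _ ha hb => rw [map_add]; exact add _ _ _ _ _ ha hb
        | neg a _ ha => rw [map_neg]; exact neg _ _ _ _ ha
        | mem a ha =>
          obtain ⟨v, rfl, hd, hall, rfl⟩ := ha
          have hq : v.word.sdeg + 1 = q - 1 := by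
            have := h.2.2
            rw [PTree.internal_node] at this
            rw [← v.sdeg_path, hd, ← this]
            push_cast
            ring
          have hb : P X Y q ((freeAInf Q).bWord v.word q hq) := by
            match v, hlen with
            | .cons t w h ξ v, _ => exact b _ _ hall q hq
          have h1 := v.bWord_word hlen hq
          rw [TreeWord.total, hΛ]
          -- The operation yields the desired element only up to the sign of the word; this is where
          -- closure under negation is needed.
          rcases Int.units_eq_one_or v.sgn with hs | hs
          · rw [hs, one_smul] at h1
            rwa [h1] at hb
          · rw [hs, Units.neg_smul, one_smul] at h1
            rw [h1] at hb
            simpa using! neg _ _ _ _ hb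
  have hx : x ∈ AddSubgroup.closure {x : (freeAInf Q).Hom X Y q | ∃ (t : PTree)
      (w : DegPath Q.Obj X Y) (ξ : Q.toGraded.tensor w),
      IsFreeIndex q t w ∧ x = freeLetter Q q t w ξ} := by
    rw [closure_freeLetter]
    trivial
  induction hx using AddSubgroup.closure_induction with
  | zero => exact zero _ _ _
  | add x y _ _ hx hy => exact add _ _ _ _ _ hx hy
  | neg x _ hx => exact neg _ _ _ _ hx
  | mem x hx =>
    obtain ⟨t, w, ξ, h, rfl⟩ := hx
    exact letter _ t (Nat.lt_succ_self _) _ _ _ _ _ h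

end

open scoped Classical
open GradedQuiver

/-! ### Evaluation of trees in an A∞-category -/

namespace GradedQuiver

variable {k : Type u} [CommRing k] (A : GradedQuiver k)

/-- The linear map given by `Φ` on `A.tensor (v.append z) ≅ A.tensor v ⊗ A.tensor z`, where `v` is
the initial part with `n` steps (and zero if there is no such decomposition). -/
def splitAt : (n : ℕ) → {X Y : A.Obj} → (w : DegPath A.Obj X Y) → {N : Type u} →
    [AddCommGroup N] → [Module k N] →
    (∀ (Z : A.Obj) (v : DegPath A.Obj X Z) (z : DegPath A.Obj Z Y),
      A.tensor v →ₗ[k] A.tensor z →ₗ[k] N) → (A.tensor w →ₗ[k] N)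
  | _, _, _, .single _, _, _, _, _ => 0
  | 0, _, _, .cons _ _, _, _, _, _ => 0
  | 1, _, _, @DegPath.cons _ _ Z _ p w, _, _, _, Φ => TensorProduct.lift (Φ Z (.single p) w)
  | n + 2, X, _, @DegPath.cons _ _ Z _ p w, N, _, _, Φ =>
      TensorProduct.lift (LinearMap.flip (splitAt (n + 1) w (N := A.Hom X Z p →ₗ[k] N)
        fun Z' v z => (LinearMap.lflip (R₀ := k)).comp (LinearMap.flip (TensorProduct.curry
          (Φ Z' (.cons p v) z : A.Hom X Z p ⊗[k] A.tensor v →ₗ[k] A.tensor z →ₗ[k] N)))))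

variable {A} {N : Type u} [AddCommGroup N] [Module k N]

theorem splitAt_cons {X Z Y : A.Obj} (n : ℕ) (hn : 1 ≤ n) (p : ℤ) (w : DegPath A.Obj Z Y)
    (Φ : ∀ (Z : A.Obj) (v : DegPath A.Obj X Z) (z : DegPath A.Obj Z Y),
      A.tensor v →ₗ[k] A.tensor z →ₗ[k] N) (x : A.Hom X Z p) (ξ : A.tensor w) :
    A.splitAt (n + 1) (DegPath.cons p w : DegPath A.Obj X Y) Φ
        (x ⊗ₜ[k] ξ : A.Hom X Z p ⊗[k] A.tensor w) =
      A.splitAt n w (N := A.Hom X Z p →ₗ[k] N)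
        (fun Z' v z => (LinearMap.lflip (R₀ := k)).comp (LinearMap.flip (TensorProduct.curry
          (Φ Z' (.cons p v) z : A.Hom X Z p ⊗[k] A.tensor v →ₗ[k] A.tensor z →ₗ[k] N)))) ξ x := by
  obtain ⟨n, rfl⟩ : ∃ m, n = m + 1 := ⟨n - 1, by omega⟩
  rfl

/-- Peeling off one letter at a time inverts `mulTensor` at the given length, which makes the
recursive evaluation on forests compute on concatenations. -/
theorem splitAt_append {X Z Y : A.Obj} (v : DegPath A.Obj X Z) (z : DegPath A.Obj Z Y)
    (Φ : ∀ (Z : A.Obj) (v : DegPath A.Obj X Z) (z : DegPath A.Obj Z Y),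
      A.tensor v →ₗ[k] A.tensor z →ₗ[k] N) (ξ : A.tensor v) (η : A.tensor z) :
    A.splitAt v.length (v.append z) Φ (A.mulTensor v z (ξ ⊗ₜ η)) = Φ Z v z ξ η := by
  induction v generalizing N with
  | single p => rfl
  | @cons X V Z p v ih =>
    have hv : 1 ≤ v.length := by cases v <;> simp [DegPath.length]
    let L₁ : (A.Hom X V p ⊗[k] A.tensor v) →ₗ[k] N :=
      (A.splitAt (v.length + 1) (DegPath.cons p (v.append z) : DegPath A.Obj X Y) Φ).comp
        ((A.mulTensor (DegPath.cons p v : DegPath A.Obj X Z) z).comp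
          ((TensorProduct.mk k (A.Hom X V p ⊗[k] A.tensor v) (A.tensor z)).flip η))
    let L₂ : (A.Hom X V p ⊗[k] A.tensor v) →ₗ[k] N := LinearMap.flip
      (Φ Z (.cons p v) z : A.Hom X V p ⊗[k] A.tensor v →ₗ[k] A.tensor z →ₗ[k] N) η
    have key : L₁ = L₂ := by
      refine TensorProduct.ext' fun x ξ => ?_
      refine (splitAt_cons v.length hv p (v.append z) Φ x _).trans ?_
      exact congrArg (fun g : A.Hom X V p →ₗ[k] N => g x) (ih z _ ξ η)
    exact LinearMap.congr_fun key ξ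

end GradedQuiver

section

variable {k : Type u} [CommRing k] {Q : DGQuiver k} {A : AInfData k} (f : Q.Obj → A.Obj)
  (f₁ : ∀ (X Y : Q.Obj) (p : ℤ), (Q.Hom X Y).X p →ₗ[k] A.Hom (f X) (f Y) p)

mutual
/-- The value of a map of graded quivers on the summand of a tree. -/
def evalTree : (t : PTree) → {X Y : Q.Obj} → (w : DegPath Q.Obj X Y) → (q : ℤ) →
    (Q.toGraded.tensor w →ₗ[k] A.Hom (f X) (f Y) q)
  | .leaf, X, Y, .single p, q => if h : p = q then h ▸ f₁ X Y p else 0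
  | .leaf, _, _, .cons _ _, _ => 0
  | .node ts, _, _, w, q =>
      (DirectSum.toModule k _ _ fun W => if h : W.sdeg + 1 = q - 1 then A.b W q h else 0).comp
        (evalForest ts w)
/-- The tensor product of the values on the summands of the trees of a forest. -/
def evalForest : (ts : List PTree) → {X Y : Q.Obj} → (w : DegPath Q.Obj X Y) →
    (Q.toGraded.tensor w →ₗ[k] A.Total (f X) (f Y))
  | [], _, _, _ => 0
  | [t], _, _, w => (A.letterι (w.sdeg + t.internal + 1)).comp
      (evalTree t w (w.sdeg + t.internal + 1))
  | t :: s :: ts, _, _, w => Q.toGraded.splitAt t.leaves w fun _ v z =>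
      ((t.internal : ℤ) * (z.sdeg + PTree.forestInternal (s :: ts))).negOnePow •
        (A.mulTotal.compl₁₂ ((A.letterι (v.sdeg + t.internal + 1)).comp
          (evalTree t v (v.sdeg + t.internal + 1))) (evalForest (s :: ts) z))
end

theorem evalTree_leaf {X Y : Q.Obj} (p : ℤ) (x : (Q.Hom X Y).X p) :
    evalTree f f₁ .leaf (.single p : DegPath Q.Obj X Y) p x = f₁ X Y p x := by
  rw [evalTree, dif_pos rfl]
  rfl

theorem evalTree_node (ts : List PTree) {X Y : Q.Obj} (w : DegPath Q.Obj X Y) (q : ℤ)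
    (ξ : Q.toGraded.tensor w) : evalTree f f₁ (.node ts) w q ξ =
      (DirectSum.toModule k _ _ fun W => if h : W.sdeg + 1 = q - 1 then A.b W q h else 0)
        (evalForest f f₁ ts w ξ) := by
  rw [evalTree]
  rfl

theorem evalForest_cons (t s : PTree) (ts : List PTree) {X Z Y : Q.Obj} (v : DegPath Q.Obj X Z)
    (z : DegPath Q.Obj Z Y) (hv : t.leaves = v.length) (ξ : Q.toGraded.tensor v)
    (η : Q.toGraded.tensor z) :
    evalForest f f₁ (t :: s :: ts) (v.append z) (Q.toGraded.mulTensor v z (ξ ⊗ₜ η)) =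
      ((t.internal : ℤ) * (z.sdeg + PTree.forestInternal (s :: ts))).negOnePow •
        A.mulTotal (A.letterι (v.sdeg + t.internal + 1) (evalTree f f₁ t v _ ξ))
          (evalForest f f₁ (s :: ts) z η) := by
  rw [evalForest, hv, splitAt_append]
  rfl

/-- The extension of a map of graded quivers to the free A∞-category. -/
def evalMap (X Y : Q.Obj) (q : ℤ) : (freeAInf Q).Hom X Y q →ₗ[k] A.Hom (f X) (f Y) q :=
  DirectSum.toModule k _ _ fun i : FreeIndex Q.Obj X Y q => evalTree f f₁ i.1.1 i.1.2 q

theorem evalMap_freeLetter {X Y : Q.Obj} {q : ℤ} {t : PTree} {w : DegPath Q.Obj X Y}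
    (h : IsFreeIndex q t w) (ξ : Q.toGraded.tensor w) :
    evalMap f f₁ X Y q (freeLetter Q q t w ξ) = evalTree f f₁ t w q ξ := by
  rw [freeLetter_eq Q h, evalMap]
  erw [DirectSum.toModule_lof]

theorem evalMap_freeLeaf {X Y : Q.Obj} (p : ℤ) (x : (Q.Hom X Y).X p) :
    evalMap f f₁ X Y p (freeLeaf Q X Y p x) = f₁ X Y p x := by
  have h : IsFreeIndex p PTree.leaf (DegPath.single p : DegPath Q.Obj X Y) := by
    simp [IsFreeIndex, PTree.Reduced, PTree.leaves, PTree.internal, DegPath.length, DegPath.sdeg]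
  exact (evalMap_freeLetter f f₁ h x).trans (evalTree_leaf f f₁ p x)

/-- The signs built into `evalForest` accumulate to the sign of the word, the same one that
`freeConcat` produces. -/
theorem evalForest_word {X Y : Q.Obj} (v : TreeWord Q X Y) :
    evalForest f f₁ v.trees v.path v.elt = v.sgn •
      A.totalι _ (Word.tprod (v.word.map (B := A.toGradedQuiver) f (evalMap f f₁))) := by
  induction v with
  | @single X Y p t w h ξ =>
    obtain rfl : p = w.sdeg + t.internal + 1 := by linarith [h.2.2]
    have h1 : evalForest f f₁ [t] w ξ = A.letterι (w.sdeg + t.internal + 1)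
        (evalTree f f₁ t w (w.sdeg + t.internal + 1) ξ) := by
      rw [evalForest]
      rfl
    refine h1.trans (Eq.trans ?_ (one_smul ℤˣ _).symm)
    rw [← evalMap_freeLetter f f₁ h]
    rfl
  | @cons X Z Y p t w h ξ v ih =>
    obtain rfl : p = w.sdeg + t.internal + 1 := by linarith [h.2.2]
    have h1 : evalForest f f₁ (t :: v.trees) (w.append v.path)
        (Q.toGraded.mulTensor w v.path (ξ ⊗ₜ v.elt)) =
          ((t.internal : ℤ) * (v.path.sdeg + PTree.forestInternal v.trees)).negOnePow •
          A.mulTotal (A.letterι (w.sdeg + t.internal + 1) (evalTree f f₁ t w _ ξ))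
            (evalForest f f₁ v.trees v.path v.elt) := by
      match v.trees, v.length_trees_pos with
      | s :: ts, _ => exact evalForest_cons f f₁ t s ts w v.path h.2.1 ξ v.elt
    refine h1.trans ?_
    rw [ih, v.sdeg_path, ← evalMap_freeLetter f f₁ h, Units.smul_def v.sgn, map_zsmul,
      ← Units.smul_def, smul_smul]
    refine congrArg _ ?_
    exact (totalι_cons (A := A.toGradedQuiver) _ _ _ _).symm

theorem commutes_evalMap_word {X Y : Q.Obj} (v : TreeWord Q X Y) (hv : 2 ≤ v.trees.length) :
    AInfData.Commutes (A := freeAInf Q) (B := A) f (evalMap f f₁) v.word := by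
  intro q hq
  -- The sign of the word occurs twice, once from the operation in `FQ` and once from the evaluation
  -- of the forest, and squares to one.
  rw [v.bWord_word hv hq, Units.smul_def, map_zsmul,
    evalMap_freeLetter f f₁ (v.isFreeIndex_node hv hq), evalTree_node, evalForest_word,
    Units.smul_def, map_zsmul, ← Units.smul_def, ← Units.smul_def, smul_smul, Int.units_mul_self,
    one_smul]
  simp only [totalι]
  erw [DirectSum.toModule_lof]
  rw [dif_pos]
  rfl

theorem commutes_evalMap_cons {X Z Y : Q.Obj} {p : ℤ} (x : (freeAInf Q).Hom X Z p)
    (w : (freeAInf Q).Word Z Y) :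
    AInfData.Commutes (A := freeAInf Q) (B := A) f (evalMap f f₁) (.cons x w) := by
  refine (AInfData.commutes_iff (A := freeAInf Q) (B := A) f (evalMap f f₁) _).2
    (sub_eq_zero.1 ?_)
  refine Word.eq_zero_of_all_cons (A := (freeAInf Q).toGradedQuiver) (X := X) (Y := Y)
    (F := fun w => AInfData.sumMap (A := freeAInf Q) (B := A) f (evalMap f f₁) X Y
      ((freeAInf Q).bTotal w) - A.bTotal (w.map (B := A.toGradedQuiver) f (evalMap f f₁)))
    (closure_freeLetter Q) (Word.IsMultiadditive.sub ?_ ?_) (fun x w hw => ?_) x w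
  · intro w w' w'' h
    exact (congrArg (AInfData.sumMap (A := freeAInf Q) (B := A) f (evalMap f f₁) X Y)
      ((AInfData.isAdditive_bTotal (freeAInf Q)).isMultiadditive _ _ _ h)).trans (map_add _ _ _)
  · intro w w' w'' h
    exact (AInfData.isAdditive_bTotal A).isMultiadditive _ _ _ (h.map _ _)
  · obtain ⟨v, hv⟩ := TreeWord.exists_word_eq _ hw
    have hlen : 2 ≤ v.trees.length := by
      match v, hv with
      | .cons t w h ξ v, _ =>
        have := v.length_trees_pos
        simp only [TreeWord.trees, List.length_cons]
        omega
    have := commutes_evalMap_word f f₁ v hlen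
    rw [hv] at this
    exact sub_eq_zero.2
      ((AInfData.commutes_iff (A := freeAInf Q) (B := A) f (evalMap f f₁) _).1 this)

end

open scoped Classical
open GradedQuiver

/-! ### The universal property of the free A∞-category -/

section

variable {k : Type u} [CommRing k] {Q : DGQuiver k}

/-- The chain map condition gives the case of generators from `Q`; `commutes_single_bWord`
propagates it through the operations. -/
theorem commutes_evalMap_single {A : AInfData k} (hA : A.IsAInf) (f : Q.Obj → A.Obj)
    (f₁ : ∀ (X Y : Q.Obj) (p : ℤ), (Q.Hom X Y).X p →ₗ[k] A.Hom (f X) (f Y) p)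
    (hf : ∀ (X Y : Q.Obj) (p : ℤ) (x : (Q.Hom X Y).X p),
      A.m₁ (f X) (f Y) p (p + 1) rfl (f₁ X Y p x) = f₁ X Y (p + 1) ((Q.Hom X Y).d p (p + 1) x))
    {X Y : Q.Obj} {p : ℤ} (y : (freeAInf Q).Hom X Y p) :
    AInfData.Commutes (A := freeAInf Q) (B := A) f (evalMap f f₁) (.single y) := by
  have hm : ∀ {X Y : Q.Obj} {p : ℤ} (y : (freeAInf Q).Hom X Y p),
      AInfData.Commutes (A := freeAInf Q) (B := A) f (evalMap f f₁) (.single y) ↔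
        (A.m₁ (f X) (f Y) p (p + 1) rfl).comp (evalMap f f₁ X Y p) y =
          (evalMap f f₁ X Y (p + 1)).comp ((freeAInf Q).m₁ X Y p (p + 1) rfl) y := by
    intro X Y p y
    have h1 : (p - 1) + 1 = (p + 1) - 1 := by ring
    refine ⟨fun h => h (p + 1) h1, fun h q hq => ?_⟩
    obtain rfl : q = p + 1 := by
      simp only [Word.sdeg, Word.shape, DegPath.sdeg] at hq
      omega
    exact h
  refine freeAInf_induction Q (P := fun X Y p y => AInfData.Commutes (A := freeAInf Q)
    (B := A) f (evalMap f f₁) (.single y))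
    (fun X Y p x => (hm _).2 ?_) (fun X Y p x y hx hy => (hm _).2 ?_)
    (fun X Y p x hx => (hm _).2 ?_) (fun x w hw q hq => ?_) y
  · refine (congrArg (A.m₁ _ _ p (p + 1) rfl) (evalMap_freeLeaf f f₁ p x)).trans ?_
    refine (hf X Y p x).trans ?_
    refine (evalMap_freeLeaf f f₁ (p + 1) _).symm.trans ?_
    exact congrArg (evalMap f f₁ X Y (p + 1)) (freeB₁_freeLeaf Q X Y p x).symm
  · rw [map_add, map_add, (hm _).1 hx, (hm _).1 hy]
  · rw [map_neg, map_neg, (hm _).1 hx]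
  · exact AInfData.commutes_single_bWord (A := freeAInf Q) (B := A)
      (isAInf_freeAInf Q) hA (fun x w => commutes_evalMap_cons _ _ x w) x w hw q hq

variable {A : AInfCategory k}

theorem m₁_map_forgetU (φ : Q ⟶ (forgetU k).obj A) (X Y : Q.Obj) (p : ℤ) (x : (Q.Hom X Y).X p) :
    A.m₁ (φ.obj X) (φ.obj Y) p (p + 1) rfl (((φ.map X Y).f p).hom x) =
      ((φ.map X Y).f (p + 1)).hom ((Q.Hom X Y).d p (p + 1) x) := by
  have h : (A.homComplex (φ.obj X) (φ.obj Y)).d p (p + 1) =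
      ModuleCat.ofHom (A.m₁ (φ.obj X) (φ.obj Y) p (p + 1) rfl) := dif_pos rfl
  have h' : (φ.map X Y).f p ≫ (A.homComplex (φ.obj X) (φ.obj Y)).d p (p + 1) = _ :=
    (φ.map X Y).comm p (p + 1)
  rw [h] at h'
  exact congrArg (fun g => g.hom x) h'

/-- The strict A∞-functor extending a morphism of differential graded quivers. -/
def freeLift (φ : Q ⟶ (forgetU k).obj A) :
    (⟨freeAInf Q, isAInf_freeAInf Q⟩ : AInfCategory k) ⟶ A where
  obj := φ.obj
  map X Y p := evalMap (A := A.toAInfData) φ.obj (fun X Y p => ((φ.map X Y).f p).hom) X Y p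
  comm X Y w q h := by
    cases w with
    | single x => exact commutes_evalMap_single (A := A.toAInfData) A.isAInf _ _ (m₁_map_forgetU φ) x q h
    | cons x w => exact commutes_evalMap_cons (A := A.toAInfData) _ _ x w q h

/-- Two strict functors agreeing on `Q` agree on everything generated from it by the operations. -/
theorem freeAInf_hom_ext {f : Q.Obj → A.Obj}
    {g g' : ∀ (X Y : Q.Obj) (p : ℤ), (freeAInf Q).Hom X Y p →ₗ[k] A.Hom (f X) (f Y) p}
    (hg : ∀ {X Y : Q.Obj} (w : (freeAInf Q).Word X Y),
      AInfData.Commutes (A := freeAInf Q) (B := A.toAInfData) f g w)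
    (hg' : ∀ {X Y : Q.Obj} (w : (freeAInf Q).Word X Y),
      AInfData.Commutes (A := freeAInf Q) (B := A.toAInfData) f g' w)
    (h : ∀ (X Y : Q.Obj) (p : ℤ) (x : (Q.Hom X Y).X p),
      g X Y p (freeLeaf Q X Y p x) = g' X Y p (freeLeaf Q X Y p x)) : g = g' := by
  funext X Y p
  refine LinearMap.ext fun y => ?_
  refine freeAInf_induction Q (P := fun X Y p y => g X Y p y = g' X Y p y) h
    (fun X Y p x y hx hy => ?_) (fun X Y p x hx => ?_) (fun x w hw q hq => ?_) y
  · rw [map_add, map_add, hx, hy]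
  · rw [map_neg, map_neg, hx]
  · refine (hg _ q hq).symm.trans (Eq.trans ?_ (hg' _ q hq))
    exact A.bWord_congr (Word.map_congr_of_all (A := (freeAInf Q).toGradedQuiver)
      (B := A.toGradedQuiver) _ hw) q _

/-- Restriction to `Q` is a bijection from the strict A∞-functors on the free A∞-category. -/
def freeHomEquiv (Q : DGQuiver k) (A : AInfCategory k) :
    ((⟨freeAInf Q, isAInf_freeAInf Q⟩ : AInfCategory k) ⟶ A) ≃ (Q ⟶ (forgetU k).obj A) where
  toFun g := freeIncl Q (isAInf_freeAInf Q) ≫ (forgetU k).map g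
  invFun := freeLift
  left_inv g := by
    obtain ⟨f, g, hg⟩ := g
    let g' := freeLift (freeIncl Q (isAInf_freeAInf Q) ≫ (forgetU k).map (⟨f, g, hg⟩ :
      StrictFunctor ⟨freeAInf Q, isAInf_freeAInf Q⟩ A))
    -- The lift has object map `f` by definition, so only the linear maps have to be compared.
    have : g'.map = g :=
      freeAInf_hom_ext (A := A) (f := f) (fun w => g'.comm _ _ w) (fun w => hg _ _ w)
        fun X Y p x => evalMap_freeLeaf (A := A.toAInfData) _ _ p x
    exact StrictFunctor.ext rfl (heq_of_eq this)
  right_inv φ := by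
    obtain ⟨f, φ⟩ := φ
    refine congrArg (DGQuiver.Morphism.mk f) ?_
    funext X Y
    ext p x
    exact evalMap_freeLeaf (A := A.toAInfData) _ _ p x

end

end AInf

end

-- The adjunction and its unit

theorem mainTheorem4 (k : Type u) [CommRing k] :
    ∃ (hA : ∀ Q : AInf.DGQuiver k, (AInf.freeAInf Q).IsAInf)
      (F : AInf.DGQuiver k ⥤ AInf.AInfCategory k)
      (hF : ∀ Q : AInf.DGQuiver k, F.obj Q = ⟨AInf.freeAInf Q, hA Q⟩)
      (adj : F ⊣ AInf.forgetU k),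
      ∀ Q : AInf.DGQuiver k,
        adj.unit.app Q ≫ (AInf.forgetU k).map (eqToHom (hF Q)) = AInf.freeIncl Q (hA Q) := by
  -- Naturality in the target alone suffices: the action of the left adjoint on morphisms is then
  -- determined by the bijections.
  have he : ∀ (Q : AInf.DGQuiver k) (A B : AInf.AInfCategory k) (g : A ⟶ B)
      (h : (⟨AInf.freeAInf Q, AInf.isAInf_freeAInf Q⟩ : AInf.AInfCategory k) ⟶ A),
      AInf.freeHomEquiv Q B (h ≫ g) =
        AInf.freeHomEquiv Q A h ≫ (AInf.forgetU k).map g := fun Q A B g h => by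
    simp only [AInf.freeHomEquiv, Equiv.coe_fn_mk, Functor.map_comp, Category.assoc]
  refine ⟨AInf.isAInf_freeAInf, Adjunction.leftAdjointOfEquiv AInf.freeHomEquiv he,
    fun Q => rfl, Adjunction.adjunctionOfEquivLeft AInf.freeHomEquiv he, fun Q => ?_⟩
  have hu : (Adjunction.adjunctionOfEquivLeft AInf.freeHomEquiv he).unit.app Q =
      AInf.freeIncl Q (AInf.isAInf_freeAInf Q) := by
    simp only [Adjunction.adjunctionOfEquivLeft, Adjunction.mkOfHomEquiv_unit_app]
    exact (congrArg (AInf.freeIncl Q (AInf.isAInf_freeAInf Q) ≫ ·)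
      ((AInf.forgetU k).map_id _)).trans (Category.comp_id _)
  rw [hu]
  -- The left adjoint has the prescribed objects by definition, so the transport along `eqToHom` is
  -- an identity.
  exact (congrArg (AInf.freeIncl Q (AInf.isAInf_freeAInf Q) ≫ ·)
    ((AInf.forgetU k).map_id _)).trans (Category.comp_id _)
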